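/- Setting. Let $P=\{p_1,\dots,p_n\}$ be $n$ points in the plane with measurements $m(p)$ and baseline values $b(p)$, all lying in an interval $[\kappa_1,\kappa_2]$ with constants $0<\kappa_1\le\kappa_2$ (that is, $m(p),b(p)=\Theta(1)$). For a region $R$ put $m_R=\sum_{p\in P\cap R}m(p)\big/\sum_{p\in P}m(p)$ and $b_R=\sum_{p\in P\cap R}b(p)\big/\sum_{p\in P}b(p)$. The Gaussian scan statistic of $R$ is $$d_G(b_R,m_R)=c\,\frac{(m_R-b_R)^2}{b_R(1-b_R)},$$ where $c>0$ is a fixed constant. Fix a constant $C>0$. A region is said to contain at least a constant measure if $(m_R,b_R)\in[C/n,\,1-C/n]^2$. In the prospective problem every point $p$ also has a timestamp $t(p)\in\mathbb R$, and the regions are $R\times[t^*,\infty)$ with $R$ an axis-parallel rectangle and $t^*\in\mathbb R$, containing the points $p\in R$ with $t(p)\ge t^*$. Running time is the number of unit-cost operations on a real RAM: exact $+,-,\times,\div$ and comparison of reals, addition, subtraction and comparison of natural numbers, and indexed memory access, without rounding. Theorem. For every accuracy $\varepsilon>0$ that is bounded above by a constant $\varepsilon_0$: 1. An axis-parallel rectangle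 that contains at least a constant measure and whose discrepancy $d_G$ is within $\varepsilon$ of the maximum of $d_G$ over all such rectangles, together with the value of its discrepancy, can be computed in time $$O\!\left(\tfrac1\varepsilon\,n^3\log n\,\log\log n\right).$$ 2. For prospective time windows, a region $R\times[t^*,\infty)$ that contains at least a constant measure and whose discrepancy $d_G$ is within $\varepsilon$ of the maximum of $d_G$ over all such regions, together with the value of its discrepancy, can be computed in time $$O\!\left(\tfrac1\varepsilon\,n^4\log n\,\log\log n\right).$$ In each case a single program, which receives $n,\varepsilon,c,C$ and the data as input, works for all instances (if no region contains at least a constant measure, it halts with arbitrary output); the time bounds hold for all $n\ge 3$, with a constant that depends only on $c,C,\kappa_1,\kappa_2,\varepsilon_0$. -/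

import Mathlib

/-! ## A real RAM with a step count

Programs over natural-number registers and arrays (used for counting and addressing) and
real-number registers and arrays. Unit-cost primitives: addition and truncated subtraction of
naturals; addition, subtraction, multiplication, division of reals; memory access by (computed)
address; comparison. There is no rounding and no conversion between reals and naturals. -/

namespace RealRAM

/-- Memory contents. Registers are numbered; an array is given by its number, its cells by
natural-number addresses. -/
structure State where
  natVar : ℕ → ℕ
  realVar : ℕ → ℝ
  natArr : ℕ → ℕ → ℕ
  realArr : ℕ → ℕ → ℝ

/-- Natural-number expressions. `get a i` reads cell `i` of array number `a`. -/
inductive NatExpr : Type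
  | lit (k : ℕ)
  | var (i : ℕ)
  | get (a : ℕ) (i : NatExpr)
  | add (e f : NatExpr)
  | sub (e f : NatExpr)

/-- The value of a natural-number expression. -/
def NatExpr.eval (s : State) : NatExpr → ℕ
  | .lit k => k
  | .var i => s.natVar i
  | .get a i => s.natArr a (i.eval s)
  | .add e f => e.eval s + f.eval s
  | .sub e f => e.eval s - f.eval s

/-- The number of primitive operations in a natural-number expression. -/
def NatExpr.cost : NatExpr → ℕ
  | .lit _ => 1
  | .var _ => 1
  | .get _ i => i.cost + 1
  | .add e f => e.cost + f.cost + 1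
  | .sub e f => e.cost + f.cost + 1

/-- Real expressions; the only literals are natural numbers, so a program carries no hidden real
data. -/
inductive RealExpr : Type
  | lit (k : ℕ)
  | var (i : ℕ)
  | get (a : ℕ) (i : NatExpr)
  | add (e f : RealExpr)
  | sub (e f : RealExpr)
  | mul (e f : RealExpr)
  | div (e f : RealExpr)

/-- The value of a real expression, in exact arithmetic (a quotient by `0` returns `0`). -/
noncomputable def RealExpr.eval (s : State) : RealExpr → ℝ
  | .lit k => (k : ℝ)
  | .var i => s.realVar i
  | .get a i => s.realArr a (i.eval s)
  | .add e f => e.eval s + f.eval s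
  | .sub e f => e.eval s - f.eval s
  | .mul e f => e.eval s * f.eval s
  | .div e f => e.eval s / f.eval s

/-- The number of primitive operations in a real expression. -/
def RealExpr.cost : RealExpr → ℕ
  | .lit _ => 1
  | .var _ => 1
  | .get _ i => i.cost + 1
  | .add e f => e.cost + f.cost + 1
  | .sub e f => e.cost + f.cost + 1
  | .mul e f => e.cost + f.cost + 1
  | .div e f => e.cost + f.cost + 1

/-- Tests: strict comparisons and their Boolean combinations. -/
inductive Test : Type
  | natLt (e f : NatExpr)
  | realLt (e f : RealExpr)
  | neg (b : Test)
  | conj (b b' : Test)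

/-- The outcome of a test. -/
def Test.holds (s : State) : Test → Prop
  | .natLt e f => e.eval s < f.eval s
  | .realLt e f => e.eval s < f.eval s
  | .neg b => ¬ b.holds s
  | .conj b b' => b.holds s ∧ b'.holds s

/-- The number of primitive operations in a test. -/
def Test.cost : Test → ℕ
  | .natLt e f => e.cost + f.cost + 1
  | .realLt e f => e.cost + f.cost + 1
  | .neg b => b.cost + 1
  | .conj b b' => b.cost + b'.cost + 1

/-- Programs: assignments to registers (`setNat`, `setReal`) and to array cells (`putNat`,
`putReal`), composition, branching and while-loops. -/
inductive Prog : Type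
  | skip
  | setNat (i : ℕ) (e : NatExpr)
  | setReal (i : ℕ) (e : RealExpr)
  | putNat (a : ℕ) (i : NatExpr) (e : NatExpr)
  | putReal (a : ℕ) (i : NatExpr) (e : RealExpr)
  | seq (P Q : Prog)
  | branch (b : Test) (P Q : Prog)
  | loop (b : Test) (P : Prog)

/-- `Exec P s t s'`: started in memory `s`, the program `P` halts after exactly `t` steps with
memory `s'`. -/
inductive Exec : Prog → State → ℕ → State → Prop
  | skip (s : State) : Exec .skip s 1 s
  | setNat (i : ℕ) (e : NatExpr) (s : State) :
      Exec (.setNat i e) s (e.cost + 1)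
        { s with natVar := Function.update s.natVar i (e.eval s) }
  | setReal (i : ℕ) (e : RealExpr) (s : State) :
      Exec (.setReal i e) s (e.cost + 1)
        { s with realVar := Function.update s.realVar i (e.eval s) }
  | putNat (a : ℕ) (i : NatExpr) (e : NatExpr) (s : State) :
      Exec (.putNat a i e) s (i.cost + e.cost + 1)
        { s with natArr := Function.update s.natArr a
                  (Function.update (s.natArr a) (i.eval s) (e.eval s)) }
  | putReal (a : ℕ) (i : NatExpr) (e : RealExpr) (s : State) :
      Exec (.putReal a i e) s (i.cost + e.cost + 1)
        { s with realArr := Function.update s.realArr a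
                  (Function.update (s.realArr a) (i.eval s) (e.eval s)) }
  | seq {P Q : Prog} {s s' s'' : State} {t t' : ℕ} :
      Exec P s t s' → Exec Q s' t' s'' → Exec (.seq P Q) s (t + t') s''
  | branchTrue {b : Test} {P Q : Prog} {s s' : State} {t : ℕ} :
      b.holds s → Exec P s t s' → Exec (.branch b P Q) s (b.cost + t) s'
  | branchFalse {b : Test} {P Q : Prog} {s s' : State} {t : ℕ} :
      ¬ b.holds s → Exec Q s t s' → Exec (.branch b P Q) s (b.cost + t) s'
  | loopTrue {b : Test} {P : Prog} {s s' s'' : State} {t t' : ℕ} :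
      b.holds s → Exec P s t s' → Exec (.loop b P) s' t' s'' →
        Exec (.loop b P) s (b.cost + t + t') s''
  | loopFalse {b : Test} {P : Prog} {s : State} :
      ¬ b.holds s → Exec (.loop b P) s b.cost s

end RealRAM

/-! ## Discrepancy -/

namespace ScanStatistic

/-- `n` points in the plane with measurements `m` and baseline values `b`. -/
structure Data (n : ℕ) where
  pts : Fin n → ℝ × ℝ
  m : Fin n → ℝ
  b : Fin n → ℝ

/-- An axis-parallel rectangle `[x₁, x₂] × [y₁, y₂]`. -/
structure Rect where
  x₁ : ℝ
  x₂ : ℝ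
  y₁ : ℝ
  y₂ : ℝ

/-- The points of a rectangle. -/
def Rect.toSet (R : Rect) : Set (ℝ × ℝ) := Set.Icc R.x₁ R.x₂ ×ˢ Set.Icc R.y₁ R.y₂

/-- The fraction of the total of `w` that is carried by the data points in `S`. -/
noncomputable def fraction {n : ℕ} (w : Fin n → ℝ) (S : Set (Fin n)) : ℝ :=
  (∑ p, S.indicator w p) / ∑ p, w p

/-- The Gaussian scan statistic `c (m - b)² / (b (1 - b))`. -/
noncomputable def dG (c b m : ℝ) : ℝ := c * (m - b) ^ 2 / (b * (1 - b))

/-- The Gaussian discrepancy of the set `S` of data points. -/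
noncomputable def Data.disc {n : ℕ} (D : Data n) (c : ℝ) (S : Set (Fin n)) : ℝ :=
  dG c (fraction D.b S) (fraction D.m S)

/-- Minimum support: `(m_S, b_S)` lies in the square `[C/n, 1 - C/n]²`. -/
def Data.Supported {n : ℕ} (D : Data n) (C : ℝ) (S : Set (Fin n)) : Prop :=
  fraction D.m S ∈ Set.Icc (C / n) (1 - C / n) ∧ fraction D.b S ∈ Set.Icc (C / n) (1 - C / n)

/-- All measurements and baseline values lie between the positive constants `κ₁` and `κ₂`. -/
def Data.Bounded {n : ℕ} (D : Data n) (κ₁ κ₂ : ℝ) : Prop :=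
  ∀ p, D.m p ∈ Set.Icc κ₁ κ₂ ∧ D.b p ∈ Set.Icc κ₁ κ₂

/-- The data points in a rectangle. -/
def Data.inRect {n : ℕ} (D : Data n) (R : Rect) : Set (Fin n) := {p | D.pts p ∈ R.toSet}

/-- The data points in the prospective region `R × [t, ∞)`, where `time` gives the timestamps. -/
def Data.inWindow {n : ℕ} (D : Data n) (time : Fin n → ℝ) (T : Rect × ℝ) : Set (Fin n) :=
  {p | D.pts p ∈ T.1.toSet ∧ T.2 ≤ time p}

/-- If the family of admissible ranges is nonempty, then `R` is an admissible range, `v` is its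
discrepancy, and `v` is within `ε` of the maximum over the family. -/
def IsAdditiveApprox {ι : Type} (adm : ι → Prop) (d : ι → ℝ) (ε : ℝ) (R : ι) (v : ℝ) : Prop :=
  (∃ R', adm R') → adm R ∧ v = d R ∧ ∀ R', adm R' → d R' ≤ v + ε

/-- The list of values of `w`, as an array padded with zeros. -/
noncomputable def toArray {n : ℕ} (w : Fin n → ℝ) (j : ℕ) : ℝ :=
  if h : j < n then w ⟨j, h⟩ else 0

/-- The input of the spatial problem: `n`; `ε, c, C`; and the arrays of the two coordinates, the
measurements and the baseline values. All other memory is zero. -/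
noncomputable def spatialInput {n : ℕ} (D : Data n) (c C ε : ℝ) : RealRAM.State where
  natVar
    | 0 => n
    | _ => 0
  realVar
    | 0 => ε
    | 1 => c
    | 2 => C
    | _ => 0
  natArr _ _ := 0
  realArr
    | 0 => toArray fun p => (D.pts p).1
    | 1 => toArray fun p => (D.pts p).2
    | 2 => toArray D.m
    | 3 => toArray D.b
    | _ => fun _ => 0

/-- The input of the prospective problem: as before, with an additional array of timestamps. -/
noncomputable def prospectiveInput {n : ℕ} (D : Data n) (time : Fin n → ℝ) (c C ε : ℝ) :
    RealRAM.State where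
  natVar
    | 0 => n
    | _ => 0
  realVar
    | 0 => ε
    | 1 => c
    | 2 => C
    | _ => 0
  natArr _ _ := 0
  realArr
    | 0 => toArray fun p => (D.pts p).1
    | 1 => toArray fun p => (D.pts p).2
    | 2 => toArray D.m
    | 3 => toArray D.b
    | 4 => toArray time
    | _ => fun _ => 0

/-- The rectangle in the output: real registers `0, 1, 2, 3`. -/
def outRect (s : RealRAM.State) : Rect :=
  ⟨s.realVar 0, s.realVar 1, s.realVar 2, s.realVar 3⟩

/-- The discrepancy value in the output: real register `4`. -/
def outValue (s : RealRAM.State) : ℝ := s.realVar 4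

/-- The starting time in the output: real register `5`. -/
def outTime (s : RealRAM.State) : ℝ := s.realVar 5

end ScanStatistic

/-! The proof exhibits one program for both problems and verifies it. The spatial problem is the
prospective problem with all timestamps zero, where a single start time suffices.

*The estimate.* All weights lie within a factor `ρ` of each other, so the fractions `m` and `b` of
a region satisfy `|m - b| ≤ 2 ρ ^ 2 b (1 - b)`. The statistic `(m - b) ^ 2 / (b (1 - b))` is jointly
convex in `m - b` and `b (1 - b)`, and by this bound its tangents have slopes depending only on
`ρ`. Hence removing `d` points from a region lowers its discrepancy by at most `8 c ρ ^ 5 d / n`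
(`Data.disc_le_disc_add`), however small the region is, as long as something is left.

*The algorithm.* The level of a point is the number of points strictly below it; equal
heights give equal levels, so the points of a slab with level in an integer interval `[u, q)` are
always cut out by a rectangle (`Data.inWindow_eq_cell`), and ties need no further care. Each
admissible region contains the same points as some such cell `[u, v)` in a slab whose sides and
start time come from data points, with `v` the number of points not above the upper edge
(`Data.exists_cell_eq_inWindow`). For each slab the program computes prefix sums by level. It then
runs through all `u`, keeps track of the least `q` at which `[u, q)` has minimum support (this `q`
increases with `u`), and examines only every `d`-th cell from there on. Rounding `v` down to an
examined value keeps the minimum support and removes fewer than `d` points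
(`Data.ncard_cell_sdiff_lt`), so the best examined cell is within `ε` when
`(d - 1) 8 c ρ ^ 5 / n ≤ ε`; the program computes `ρ` and the largest such `d` from the input.

*The time.* A slab costs `O(n (n / d + 1))`, where the movement of the least supported `q` is
amortized, and `n / d + 1 = O(1 / ε)`. With `n ^ 2` pairs of sides and `H` start times this gives
`O(H n ^ 3 / ε)`, where `H` is `1` or `n`. The logarithmic factors of the claim are
bounded below for `n ≥ 3`, so they are not needed.

Programs are verified with `Run P s Q`, total correctness with a step count. The main rule is
`Run.loop`, in which a potential pays for the rounds of a loop; syntactic frame conditions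
(`Exec.frame`) account for the memory that a program leaves alone. -/

/-! ### Reasoning about executions -/

namespace RealRAM

/-- `P`, started in `s`, halts, and its step count and final memory satisfy `Q`. -/
def Run (P : Prog) (s : State) (Q : ℕ → State → Prop) : Prop :=
  ∃ t s', Exec P s t s' ∧ Q t s'

theorem Run.mono {P : Prog} {s : State} {Q R : ℕ → State → Prop} (h : Run P s Q)
    (hQR : ∀ t s', Q t s' → R t s') : Run P s R :=
  let ⟨t, s', he, hq⟩ := h
  ⟨t, s', he, hQR t s' hq⟩

theorem run_skip_iff {s : State} {Q : ℕ → State → Prop} : Run .skip s Q ↔ Q 1 s := by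
  refine ⟨?_, fun h => ⟨_, _, .skip s, h⟩⟩
  rintro ⟨t, s', he, hq⟩
  cases he
  exact hq

theorem run_setNat_iff {i : ℕ} {e : NatExpr} {s : State} {Q : ℕ → State → Prop} :
    Run (.setNat i e) s Q ↔
      Q (e.cost + 1) { s with natVar := Function.update s.natVar i (e.eval s) } := by
  refine ⟨?_, fun h => ⟨_, _, .setNat i e s, h⟩⟩
  rintro ⟨t, s', he, hq⟩
  cases he
  exact hq

theorem run_setReal_iff {i : ℕ} {e : RealExpr} {s : State} {Q : ℕ → State → Prop} :
    Run (.setReal i e) s Q ↔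
      Q (e.cost + 1) { s with realVar := Function.update s.realVar i (e.eval s) } := by
  refine ⟨?_, fun h => ⟨_, _, .setReal i e s, h⟩⟩
  rintro ⟨t, s', he, hq⟩
  cases he
  exact hq

theorem run_putNat_iff {a : ℕ} {i e : NatExpr} {s : State} {Q : ℕ → State → Prop} :
    Run (.putNat a i e) s Q ↔
      Q (i.cost + e.cost + 1) { s with
        natArr := Function.update s.natArr a
          (Function.update (s.natArr a) (i.eval s) (e.eval s)) } := by
  refine ⟨?_, fun h => ⟨_, _, .putNat a i e s, h⟩⟩
  rintro ⟨t, s', he, hq⟩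
  cases he
  exact hq

theorem run_putReal_iff {a : ℕ} {i : NatExpr} {e : RealExpr} {s : State}
    {Q : ℕ → State → Prop} :
    Run (.putReal a i e) s Q ↔
      Q (i.cost + e.cost + 1) { s with
        realArr := Function.update s.realArr a
          (Function.update (s.realArr a) (i.eval s) (e.eval s)) } := by
  refine ⟨?_, fun h => ⟨_, _, .putReal a i e s, h⟩⟩
  rintro ⟨t, s', he, hq⟩
  cases he
  exact hq

theorem run_seq_iff {P P' : Prog} {s : State} {Q : ℕ → State → Prop} :
    Run (.seq P P') s Q ↔ Run P s fun t s' => Run P' s' fun t' s'' => Q (t + t') s'' := by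
  constructor
  · rintro ⟨t, s', he, hq⟩
    cases he with
    | seq h₁ h₂ => exact ⟨_, _, h₁, _, _, h₂, hq⟩
  · rintro ⟨t, s', h₁, t', s'', h₂, hq⟩
    exact ⟨_, _, .seq h₁ h₂, hq⟩

theorem run_branch_iff {b : Test} {P P' : Prog} {s : State} {Q : ℕ → State → Prop} :
    Run (.branch b P P') s Q ↔
      (b.holds s → Run P s fun t s' => Q (b.cost + t) s') ∧
      (¬ b.holds s → Run P' s fun t s' => Q (b.cost + t) s') := by
  constructor
  · rintro ⟨t, s', he, hq⟩
    cases he with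
    | branchTrue hb h => exact ⟨fun _ => ⟨_, _, h, hq⟩, fun h' => absurd hb h'⟩
    | branchFalse hb h => exact ⟨fun h' => absurd h' hb, fun _ => ⟨_, _, h, hq⟩⟩
  · rintro ⟨h₁, h₂⟩
    by_cases hb : b.holds s
    · obtain ⟨t, s', h, hq⟩ := h₁ hb
      exact ⟨_, _, .branchTrue hb h, hq⟩
    · obtain ⟨t, s', h, hq⟩ := h₂ hb
      exact ⟨_, _, .branchFalse hb h, hq⟩

theorem Run.seq {P P' : Prog} {s : State} {Q R : ℕ → State → Prop} (h : Run P s R)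
    (h' : ∀ t s', R t s' → Run P' s' fun t' s'' => Q (t + t') s'') : Run (.seq P P') s Q :=
  run_seq_iff.2 (h.mono h')

theorem Test.cost_pos (b : Test) : 0 < b.cost := by
  cases b <;> simp [Test.cost]

/-- Amortized rule for loops: `φ` is a potential that pays for the test and the body of every
round. Termination needs no separate argument, since a test costs at least one step. -/
theorem Run.loop {b : Test} {P : Prog} (I : State → Prop) (φ : State → ℕ)
    (step : ∀ s, I s → b.holds s → Run P s fun t s' => I s' ∧ φ s' + (b.cost + t) ≤ φ s)
    {s : State} (h : I s) :
    Run (.loop b P) s fun t s' => I s' ∧ ¬ b.holds s' ∧ t ≤ φ s + b.cost := by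
  induction hk : φ s using Nat.strong_induction_on generalizing s with
  | _ k ih =>
    subst hk
    by_cases hb : b.holds s
    · obtain ⟨t, s', he, hI, hφ⟩ := step s h hb
      have := b.cost_pos
      obtain ⟨t', s'', he', hI', hb', ht'⟩ := ih (φ s') (by omega) hI rfl
      exact ⟨_, _, .loopTrue hb he he', hI', hb', by omega⟩
    · exact ⟨_, _, .loopFalse hb, h, hb, by omega⟩

/-! ### Memory that a program leaves alone -/

/-- The natural-number registers that occur as targets of assignments. -/
def Prog.natWrites : Prog → List ℕ
  | .setNat i _ => [i]
  | .seq P Q => P.natWrites ++ Q.natWrites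
  | .branch _ P Q => P.natWrites ++ Q.natWrites
  | .loop _ P => P.natWrites
  | _ => []

/-- The real registers that occur as targets of assignments. -/
def Prog.realWrites : Prog → List ℕ
  | .setReal i _ => [i]
  | .seq P Q => P.realWrites ++ Q.realWrites
  | .branch _ P Q => P.realWrites ++ Q.realWrites
  | .loop _ P => P.realWrites
  | _ => []

/-- The natural-number arrays that occur as targets of assignments. -/
def Prog.natArrWrites : Prog → List ℕ
  | .putNat a _ _ => [a]
  | .seq P Q => P.natArrWrites ++ Q.natArrWrites
  | .branch _ P Q => P.natArrWrites ++ Q.natArrWrites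
  | .loop _ P => P.natArrWrites
  | _ => []

/-- The real arrays that occur as targets of assignments. -/
def Prog.realArrWrites : Prog → List ℕ
  | .putReal a _ _ => [a]
  | .seq P Q => P.realArrWrites ++ Q.realArrWrites
  | .branch _ P Q => P.realArrWrites ++ Q.realArrWrites
  | .loop _ P => P.realArrWrites
  | _ => []

/-- `s` and `s'` agree on all registers and arrays that `P` does not assign to. -/
structure Frame (P : Prog) (s s' : State) : Prop where
  nat : ∀ i, i ∉ P.natWrites → s'.natVar i = s.natVar i
  real : ∀ i, i ∉ P.realWrites → s'.realVar i = s.realVar i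
  natArr : ∀ a, a ∉ P.natArrWrites → s'.natArr a = s.natArr a
  realArr : ∀ a, a ∉ P.realArrWrites → s'.realArr a = s.realArr a

theorem Frame.refl (P : Prog) (s : State) : Frame P s s :=
  ⟨fun _ _ => rfl, fun _ _ => rfl, fun _ _ => rfl, fun _ _ => rfl⟩

theorem Frame.trans {P : Prog} {s s' s'' : State} (h : Frame P s s') (h' : Frame P s' s'') :
    Frame P s s'' :=
  ⟨fun i hi => (h'.nat i hi).trans (h.nat i hi), fun i hi => (h'.real i hi).trans (h.real i hi),
    fun i hi => (h'.natArr i hi).trans (h.natArr i hi),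
    fun i hi => (h'.realArr i hi).trans (h.realArr i hi)⟩

theorem Frame.seq_left {P : Prog} (Q : Prog) {s s' : State} (h : Frame P s s') :
    Frame (.seq P Q) s s' :=
  ⟨fun i hi => h.nat i fun h' => hi (List.mem_append_left _ h'),
    fun i hi => h.real i fun h' => hi (List.mem_append_left _ h'),
    fun i hi => h.natArr i fun h' => hi (List.mem_append_left _ h'),
    fun i hi => h.realArr i fun h' => hi (List.mem_append_left _ h')⟩

theorem Frame.seq_right (P : Prog) {Q : Prog} {s s' : State} (h : Frame Q s s') :
    Frame (.seq P Q) s s' :=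
  ⟨fun i hi => h.nat i fun h' => hi (List.mem_append_right _ h'),
    fun i hi => h.real i fun h' => hi (List.mem_append_right _ h'),
    fun i hi => h.natArr i fun h' => hi (List.mem_append_right _ h'),
    fun i hi => h.realArr i fun h' => hi (List.mem_append_right _ h')⟩

theorem Frame.loop {b : Test} {P : Prog} {s s' : State} (h : Frame P s s') :
    Frame (.loop b P) s s' :=
  ⟨h.nat, h.real, h.natArr, h.realArr⟩

theorem Exec.frame {P : Prog} {s s' : State} {t : ℕ} (h : Exec P s t s') : Frame P s s' := by
  induction h with
  | skip s => exact .refl _ _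
  | setNat i e s =>
    refine ⟨fun j hj => ?_, fun _ _ => rfl, fun _ _ => rfl, fun _ _ => rfl⟩
    exact Function.update_of_ne (by simpa [Prog.natWrites] using hj) _ _
  | setReal i e s =>
    refine ⟨fun _ _ => rfl, fun j hj => ?_, fun _ _ => rfl, fun _ _ => rfl⟩
    exact Function.update_of_ne (by simpa [Prog.realWrites] using hj) _ _
  | putNat a i e s =>
    refine ⟨fun _ _ => rfl, fun _ _ => rfl, fun j hj => ?_, fun _ _ => rfl⟩
    exact Function.update_of_ne (by simpa [Prog.natArrWrites] using hj) _ _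
  | putReal a i e s =>
    refine ⟨fun _ _ => rfl, fun _ _ => rfl, fun _ _ => rfl, fun j hj => ?_⟩
    exact Function.update_of_ne (by simpa [Prog.realArrWrites] using hj) _ _
  | seq _ _ ih ih' => exact (ih.seq_left _).trans (ih'.seq_right _)
  | branchTrue _ _ ih =>
    have := ih.seq_left
    exact ⟨(this _).nat, (this _).real, (this _).natArr, (this _).realArr⟩
  | branchFalse _ _ ih =>
    have := ih.seq_right
    exact ⟨(this _).nat, (this _).real, (this _).natArr, (this _).realArr⟩
  | loopTrue _ _ _ ih ih' => exact ih.loop.trans ih'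
  | loopFalse _ => exact .refl _ _

theorem Run.frame {P : Prog} {s : State} {Q : ℕ → State → Prop} (h : Run P s Q) :
    Run P s fun t s' => Frame P s s' ∧ Q t s' :=
  let ⟨t, s', he, hq⟩ := h
  ⟨t, s', he, he.frame, hq⟩

/-- Loop rule that also provides the memory left alone since the loop was entered. -/
theorem Run.loop_frame {b : Test} {P : Prog} (I : State → Prop) (φ : State → ℕ) {s : State}
    (step : ∀ s', Frame P s s' → I s' → b.holds s' →
      Run P s' fun t s'' => I s'' ∧ φ s'' + (b.cost + t) ≤ φ s')
    (h : I s) :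
    Run (.loop b P) s fun t s' =>
      Frame P s s' ∧ I s' ∧ ¬ b.holds s' ∧ t ≤ φ s + b.cost := by
  refine (Run.loop (fun s' => Frame P s s' ∧ I s') φ ?_ ⟨.refl _ _, h⟩).mono ?_
  · rintro s' ⟨hf, hI⟩ hb
    exact (step s' hf hI hb).frame.mono fun t s'' ⟨hf', hI', hφ⟩ => ⟨⟨hf.trans hf', hI'⟩, hφ⟩
  · rintro t s' ⟨⟨hf, hI⟩, hb, ht⟩
    exact ⟨hf, hI, hb, ht⟩

/-- `for i = 0, …, r - 1 do P`, where `i` and `r` are registers. -/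
def Prog.forLt (i r : ℕ) (P : Prog) : Prog :=
  .seq (.setNat i (.lit 0)) (.loop (.natLt (.var i) (.var r))
    (.seq P (.setNat i (.add (.var i) (.lit 1)))))

theorem Run.forLt {i r : ℕ} {P : Prog} {s : State} {N T : ℕ} (I : ℕ → State → Prop)
    (hN : s.natVar r = N) (hri : r ≠ i) (hr : r ∉ P.natWrites) (hi : i ∉ P.natWrites)
    (congr : ∀ k s a, I k s → I k { s with natVar := Function.update s.natVar i a })
    (init : I 0 s)
    (step : ∀ k s', k < N → Frame (Prog.forLt i r P) s s' → s'.natVar i = k → I k s' →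
      Run P s' fun t s'' => t ≤ T ∧ I (k + 1) s'') :
    Run (Prog.forLt i r P) s fun t s' =>
      t ≤ N * (T + 7) + 5 ∧ Frame (Prog.forLt i r P) s s' ∧ I N s' := by
  refine Run.seq (run_setNat_iff.2 rfl : Run _ s fun t s' =>
    (t, s') = (2, { s with natVar := Function.update s.natVar i 0 })) ?_
  rintro t s' h
  obtain ⟨rfl, rfl⟩ := Prod.mk.inj h
  have hf0 : Frame (Prog.forLt i r P) s
      { s with natVar := Function.update s.natVar i 0 } :=
    (Exec.setNat i (.lit 0) s).frame.seq_left _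
  refine (Run.loop (b := .natLt (.var i) (.var r)) (fun s' => Frame (Prog.forLt i r P) s s' ∧
    s'.natVar r = N ∧ s'.natVar i ≤ N ∧ I (s'.natVar i) s')
    (fun s' => (N - s'.natVar i) * (T + 7)) ?_ ?_).mono ?_
  · rintro s' ⟨hf, hN', hle, hI⟩ hb
    simp only [Test.holds, NatExpr.eval, hN'] at hb
    refine Run.seq (step _ s' hb hf rfl hI).frame ?_
    rintro t s'' ⟨hf', ht, hI'⟩
    have hi' := hf'.nat i hi
    have hr' := hf'.nat r hr
    rw [run_setNat_iff]
    have hf'' := (Exec.setNat i (.add (.var i) (.lit 1)) s'').frame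
    refine ⟨⟨hf.trans (Frame.seq_right _ (hf'.seq_left _ |>.trans (hf''.seq_right _)).loop),
      ?_, ?_, ?_⟩, ?_⟩
    · simp [Function.update_of_ne hri, hr', hN']
    · simp only [NatExpr.eval, Function.update_self, hi']
      omega
    · simp only [NatExpr.eval, Function.update_self, hi']
      exact congr _ _ _ hI'
    · simp only [NatExpr.eval, Function.update_self, hi', NatExpr.cost, Test.cost]
      obtain ⟨m, hm⟩ : ∃ m, N - s'.natVar i = m + 1 := ⟨N - s'.natVar i - 1, by omega⟩
      rw [hm, show N - (s'.natVar i + 1) = m by omega, Nat.succ_mul]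
      omega
  · refine ⟨hf0, ?_, ?_, ?_⟩
    · simp [Function.update_of_ne hri, hN]
    · simp
    · simpa using congr _ _ 0 init
  · rintro t s' ⟨⟨hf, hN', hle, hI⟩, hb, ht⟩
    simp only [Test.holds, NatExpr.eval, hN'] at hb
    have : s'.natVar i = N := by omega
    rw [this] at hI
    refine ⟨?_, hf, hI⟩
    simp only [Function.update_self, Nat.sub_zero, Test.cost, NatExpr.cost] at ht
    omega

end RealRAM

namespace ScanStatistic

open RealRAM

/-! ### Sensitivity of the discrepancy -/

/-- One-sided Lipschitz estimate. With `g = m - b` and `v = b (1 - b)` the statistic is the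
jointly convex function `g ^ 2 / v`, so it lies above its tangent at `(g, v)`, whose slopes are
`2 g / v` and `-(g / v) ^ 2`. -/
theorem dG_le_add {c b m b' m' R δ : ℝ} (hc : 0 ≤ c) (hb : 0 < b) (hb1 : b < 1)
    (hb' : 0 < b') (hb1' : b' < 1) (hR : |m - b| ≤ R * (b * (1 - b)))
    (hbb : b' ≤ b) (hbδ : b - b' ≤ δ) (hmm : m' ≤ m) (hmδ : m - m' ≤ δ) :
    dG c b m ≤ dG c b' m' + c * (2 * R + R ^ 2) * δ := by
  have hv : 0 < b * (1 - b) := mul_pos hb (by linarith)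
  have hv' : 0 < b' * (1 - b') := mul_pos hb' (by linarith)
  have hδ : 0 ≤ δ := by linarith
  set r := (m - b) / (b * (1 - b)) with hr
  have hrg : m - b = r * (b * (1 - b)) := by
    rw [hr, div_mul_cancel₀ _ hv.ne']
  have hrR : |r| ≤ R := by
    rw [hr, abs_div, abs_of_pos hv, div_le_iff₀ hv]
    exact hR
  have hR0 : 0 ≤ R := (abs_nonneg _).trans hrR
  have h1 : (m - b) ^ 2 / (b * (1 - b)) = r ^ 2 * (b * (1 - b)) := by
    rw [hrg]; field_simp
  have h2 : 2 * r * (m' - b') - r ^ 2 * (b' * (1 - b')) ≤ (m' - b') ^ 2 / (b' * (1 - b')) := by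
    rw [le_div_iff₀ hv']
    nlinarith [sq_nonneg ((m' - b') - r * (b' * (1 - b')))]
  have h3 : r * ((m - b) - (m' - b')) ≤ R * δ := by
    refine (le_abs_self _).trans ?_
    rw [abs_mul]
    refine mul_le_mul hrR ?_ (abs_nonneg _) hR0
    rw [abs_le]; constructor <;> linarith
  have h4 : r ^ 2 * (b' * (1 - b') - b * (1 - b)) ≤ R ^ 2 * δ := by
    have h5 : r ^ 2 ≤ R ^ 2 := by
      rw [← sq_abs]; exact pow_le_pow_left₀ (abs_nonneg _) hrR 2
    have h6 : b' * (1 - b') - b * (1 - b) ≤ δ := by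
      nlinarith [mul_nonneg (sub_nonneg.2 hbb) (show 0 ≤ 2 - b - b' by linarith)]
    calc _ ≤ r ^ 2 * δ := mul_le_mul_of_nonneg_left h6 (sq_nonneg r)
      _ ≤ R ^ 2 * δ := mul_le_mul_of_nonneg_right h5 hδ
  have h7 : (m - b) ^ 2 / (b * (1 - b)) ≤
      (m' - b') ^ 2 / (b' * (1 - b')) + (2 * R + R ^ 2) * δ := by
    have h8 : r * (m - b) = r ^ 2 * (b * (1 - b)) := by
      have := congrArg (r * ·) hrg
      rw [this]; ring
    rw [h1]
    linarith
  unfold dG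
  rw [mul_div_assoc, mul_div_assoc]
  nlinarith [mul_le_mul_of_nonneg_left h7 hc]

section Fractions

variable {n : ℕ}

theorem fraction_sdiff (w : Fin n → ℝ) {S S' : Set (Fin n)} (h : S' ⊆ S) :
    fraction w S - fraction w S' = fraction w (S \ S') := by
  simp only [fraction, Set.indicator_sdiff h, Pi.sub_apply, Finset.sum_sub_distrib, sub_div]

theorem fraction_nonneg {w : Fin n → ℝ} (hw : ∀ p, 0 ≤ w p) (S : Set (Fin n)) :
    0 ≤ fraction w S :=
  div_nonneg (Finset.sum_nonneg fun p _ => Set.indicator_nonneg (fun p _ => hw p) p)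
    (Finset.sum_nonneg fun p _ => hw p)

theorem fraction_mono {w : Fin n → ℝ} (hw : ∀ p, 0 ≤ w p) {S S' : Set (Fin n)} (h : S' ⊆ S) :
    fraction w S' ≤ fraction w S := by
  have := fraction_nonneg hw (S \ S')
  rw [← fraction_sdiff w h] at this
  linarith

theorem sum_pos_of_le {w : Fin n → ℝ} {l : ℝ} (hn : 0 < n) (hl : 0 < l) (hw : ∀ p, l ≤ w p) :
    0 < ∑ p, w p := by
  have : Nonempty (Fin n) := ⟨⟨0, hn⟩⟩
  exact Finset.sum_pos (fun p _ => hl.trans_le (hw p)) Finset.univ_nonempty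

theorem one_sub_fraction {w : Fin n → ℝ} (hw : ∑ p, w p ≠ 0) (S : Set (Fin n)) :
    1 - fraction w S = fraction w Sᶜ := by
  have h : fraction w Set.univ = 1 := by simp [fraction, hw]
  rw [← h, fraction_sdiff w (Set.subset_univ S), Set.compl_eq_univ_sdiff]

theorem fraction_le_sq_mul {w w' : Fin n → ℝ} {l k : ℝ} (hn : 0 < n) (hl : 0 < l)
    (hw : ∀ p, w p ∈ Set.Icc l k) (hw' : ∀ p, w' p ∈ Set.Icc l k) (S : Set (Fin n)) :
    fraction w S ≤ (k / l) ^ 2 * fraction w' S := by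
  have hk : 0 < k := hl.trans_le ((hw ⟨0, hn⟩).1.trans (hw ⟨0, hn⟩).2)
  have key : ∀ {a b : ℝ}, a ∈ Set.Icc l k → b ∈ Set.Icc l k → a ≤ k / l * b := by
    intro a b ha hb
    rw [div_mul_eq_mul_div, le_div_iff₀ hl]
    exact mul_le_mul ha.2 hb.1 hl.le hk.le
  have hpos := sum_pos_of_le hn hl fun p => (hw p).1
  have hpos' := sum_pos_of_le hn hl fun p => (hw' p).1
  have h1 : ∑ p, S.indicator w p ≤ k / l * ∑ p, S.indicator w' p := by
    rw [Finset.mul_sum]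
    refine Finset.sum_le_sum fun p _ => ?_
    by_cases hp : p ∈ S
    · simpa [hp] using key (hw p) (hw' p)
    · simp [hp]
  have h2 : ∑ p, w' p ≤ k / l * ∑ p, w p := by
    rw [Finset.mul_sum]
    exact Finset.sum_le_sum fun p _ => key (hw' p) (hw p)
  have h3 : 0 ≤ ∑ p, S.indicator w' p :=
    Finset.sum_nonneg fun p _ => Set.indicator_nonneg (fun p _ => hl.le.trans (hw' p).1) p
  unfold fraction
  rw [← mul_div_assoc, div_le_div_iff₀ hpos hpos']
  calc _ ≤ (k / l * ∑ p, S.indicator w' p) * (k / l * ∑ p, w p) :=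
        mul_le_mul h1 h2 hpos'.le (by positivity)
    _ = _ := by ring

theorem fraction_le_ncard {w : Fin n → ℝ} {l k : ℝ} (hn : 0 < n) (hl : 0 < l)
    (hw : ∀ p, w p ∈ Set.Icc l k) (S : Set (Fin n)) :
    fraction w S ≤ k / l * S.ncard / n := by
  classical
  have hpos := sum_pos_of_le hn hl fun p => (hw p).1
  have hk : 0 < k := hl.trans_le ((hw ⟨0, hn⟩).1.trans (hw ⟨0, hn⟩).2)
  have hn' : (0 : ℝ) < n := by exact_mod_cast hn
  have h1 : ∑ p, S.indicator w p ≤ k * S.ncard := by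
    calc _ ≤ ∑ p, S.indicator (fun _ => k) p := by
          refine Finset.sum_le_sum fun p _ => ?_
          exact Set.indicator_le_indicator (hw p).2
      _ = _ := by
          simp only [Set.indicator_apply]
          rw [← Finset.sum_filter, Finset.sum_const, nsmul_eq_mul, mul_comm,
            Set.ncard_eq_toFinset_card', ]
          congr 3
          ext; simp
  have h2 : l * n ≤ ∑ p, w p := by
    calc l * n = ∑ _p : Fin n, l := by simp [mul_comm]
      _ ≤ _ := Finset.sum_le_sum fun p _ => (hw p).1
  unfold fraction
  calc _ ≤ (k * S.ncard) / (l * n) :=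
        div_le_div₀ (by positivity) h1 (by positivity) h2
    _ = _ := by field_simp

/-- Removing `d` points from a region changes its discrepancy by `O(d / n)`, whatever the size of
the region: since all weights are comparable, `|m - b| = O(b (1 - b))`. -/
theorem Data.disc_le_disc_add {D : Data n} {c l k : ℝ} (hc : 0 ≤ c) (hn : 0 < n) (hl : 0 < l)
    (hD : D.Bounded l k) {S S' : Set (Fin n)} (hS : S' ⊆ S)
    (h0 : 0 < fraction D.b S') (h1 : fraction D.b S < 1) :
    D.disc c S ≤ D.disc c S' + 8 * c * (k / l) ^ 5 / n * (S \ S').ncard := by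
  set ρ := k / l with hρ
  have hρ1 : 1 ≤ ρ := by
    rw [hρ, one_le_div hl]
    exact (hD ⟨0, hn⟩).1.1.trans (hD ⟨0, hn⟩).1.2
  have hm p := (hD p).1
  have hb p := (hD p).2
  have hm0 p : 0 ≤ D.m p := hl.le.trans (hm p).1
  have hb0 p : 0 ≤ D.b p := hl.le.trans (hb p).1
  have hbS := fraction_mono hb0 hS
  have hmS := fraction_mono hm0 hS
  have hn' : (0 : ℝ) < n := by exact_mod_cast hn
  have hR : |fraction D.m S - fraction D.b S| ≤
      (2 * ρ ^ 2) * (fraction D.b S * (1 - fraction D.b S)) := by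
    have e1 := fraction_le_sq_mul hn hl hm hb S
    have e3 := fraction_le_sq_mul hn hl hm hb Sᶜ
    have e5 := fraction_nonneg hm0 S
    have e6 := fraction_nonneg hm0 Sᶜ
    rw [← one_sub_fraction (sum_pos_of_le hn hl fun p => (hm p).1).ne'] at e3 e6
    rw [← one_sub_fraction (sum_pos_of_le hn hl fun p => (hb p).1).ne'] at e3
    generalize fraction D.m S = m at *
    generalize fraction D.b S = b at *
    rw [← hρ] at e1 e3
    have hb' : 0 < b := h0.trans_le hbS
    have hρ2 : 1 ≤ ρ ^ 2 := one_le_pow₀ hρ1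
    have k1 : |m - b| ≤ ρ ^ 2 * b := by
      rw [abs_le]; constructor <;> nlinarith
    have k2 : |m - b| ≤ ρ ^ 2 * (1 - b) := by
      rw [abs_le]; constructor <;> nlinarith
    -- `min b (1 - b) ≤ 2 b (1 - b)`, because the larger of the two is at least `1 / 2`
    rcases le_total b (1 / 2) with hh | hh
    · refine k1.trans ?_
      have : b ≤ 2 * (b * (1 - b)) := by nlinarith
      nlinarith
    · refine k2.trans ?_
      have : 1 - b ≤ 2 * (b * (1 - b)) := by nlinarith
      nlinarith
  have h := dG_le_add (δ := ρ * (S \ S').ncard / n) hc (h0.trans_le hbS) h1 h0 (hbS.trans_lt h1)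
    hR hbS (by rw [fraction_sdiff _ hS]; exact fraction_le_ncard hn hl hb _) hmS
    (by rw [fraction_sdiff _ hS]; exact fraction_le_ncard hn hl hm _)
  refine h.trans (add_le_add le_rfl ?_)
  have : (2 * (2 * ρ ^ 2) + (2 * ρ ^ 2) ^ 2) * ρ ≤ 8 * ρ ^ 5 := by
    have : ρ ^ 3 ≤ ρ ^ 5 := pow_le_pow_right₀ hρ1 (by norm_num)
    nlinarith
  calc c * (2 * (2 * ρ ^ 2) + (2 * ρ ^ 2) ^ 2) * (ρ * (S \ S').ncard / n)
      = c * ((2 * (2 * ρ ^ 2) + (2 * ρ ^ 2) ^ 2) * ρ) * ((S \ S').ncard / n) := by ring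
    _ ≤ c * (8 * ρ ^ 5) * ((S \ S').ncard / n) := by gcongr
    _ = _ := by ring

end Fractions

/-! ### Levels -/

/-- The number of indices below `n` with a value strictly smaller than `y p`. Equal values have
equal levels. -/
noncomputable def level (y : ℕ → ℝ) (n p : ℕ) : ℕ := ((Finset.range n).filter (y · < y p)).card

section Level

variable {y : ℕ → ℝ} {n : ℕ}

theorem level_lt_card_le {p₀ p : ℕ} (hp : p < n) :
    level y n p < ((Finset.range n).filter (y · ≤ y p₀)).card ↔ y p ≤ y p₀ := by
  constructor
  · intro h
    by_contra! h'
    refine h.not_ge (Finset.card_le_card fun r hr => ?_)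
    simp only [Finset.mem_filter] at hr ⊢
    exact ⟨hr.1, hr.2.trans_lt h'⟩
  · intro h
    refine Finset.card_lt_card (Finset.ssubset_iff_subset_ne.2 ⟨fun r hr => ?_, fun h' => ?_⟩)
    · simp only [Finset.mem_filter] at hr ⊢
      exact ⟨hr.1, hr.2.le.trans h⟩
    · have : p ∈ (Finset.range n).filter (y · ≤ y p₀) := by simp [hp, h]
      rw [← h'] at this
      simp at this

theorem level_mono {p r : ℕ} (h : y p ≤ y r) : level y n p ≤ level y n r := by
  refine Finset.card_le_card fun a ha => ?_
  simp only [Finset.mem_filter] at ha ⊢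
  exact ⟨ha.1, ha.2.trans_le h⟩

theorem level_lt_level {p r : ℕ} (hp : p < n) (h : y p < y r) : level y n p < level y n r := by
  refine ((level_lt_card_le hp).2 le_rfl).trans_le (Finset.card_le_card fun a ha => ?_)
  simp only [Finset.mem_filter] at ha ⊢
  exact ⟨ha.1, ha.2.trans_lt h⟩

theorem level_le_level_iff {p r : ℕ} (hr : r < n) :
    level y n p ≤ level y n r ↔ y p ≤ y r :=
  ⟨fun h => not_lt.1 fun h' => (level_lt_level hr h').not_ge h, level_mono⟩

theorem level_lt {p : ℕ} (hp : p < n) : level y n p < n := by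
  refine (Finset.card_lt_card (t := Finset.range n) ?_).trans_eq (Finset.card_range n)
  refine Finset.filter_ssubset.2 ⟨p, by simpa using hp, lt_irrefl _⟩

theorem le_card_level_lt {q : ℕ} (hq : q ≤ n) :
    q ≤ ((Finset.range n).filter (level y n · < q)).card := by
  by_cases h : ((Finset.range n).filter (q ≤ level y n ·)).Nonempty
  · obtain ⟨p, hp, hmin⟩ := Finset.exists_min_image _ y h
    simp only [Finset.mem_filter, Finset.mem_range] at hp hmin
    refine hp.2.trans (Finset.card_le_card fun r hr => ?_)
    simp only [Finset.mem_filter, Finset.mem_range] at hr ⊢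
    refine ⟨hr.1, ?_⟩
    by_contra! h'
    exact (hmin r ⟨hr.1, h'⟩).not_gt hr.2
  · rw [Finset.not_nonempty_iff_eq_empty] at h
    have : (Finset.range n).filter (level y n · < q) = Finset.range n := by
      refine Finset.filter_true_of_mem fun p hp => ?_
      by_contra! h'
      exact Finset.notMem_empty p (h ▸ Finset.mem_filter.2 ⟨hp, h'⟩)
    rw [this, Finset.card_range]
    exact hq

/-- If exactly `v` indices have a level below `v`, then fewer than `s` of them have a level in
`[q, v)` for every `q > v - s`. -/
theorem card_level_mem_Ico_lt {q v s : ℕ} (hqv : q ≤ v) (hvs : v < q + s) (hv : v ≤ n)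
    (htight : ((Finset.range n).filter (level y n · < v)).card = v) :
    ((Finset.range n).filter fun p => q ≤ level y n p ∧ level y n p < v).card < s := by
  have h := le_card_level_lt (y := y) (hqv.trans hv)
  have h' : ((Finset.range n).filter fun p => q ≤ level y n p ∧ level y n p < v).card +
      ((Finset.range n).filter (level y n · < q)).card = v := by
    rw [← Finset.card_union_of_disjoint, ← htight]
    · congr 1
      ext p
      simp only [Finset.mem_union, Finset.mem_filter, htight]
      constructor
      · rintro (h | h)
        · exact ⟨h.1, h.2.2⟩
        · exact ⟨h.1, h.2.trans_le hqv⟩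
      · rintro ⟨h1, h2⟩
        rcases le_or_gt q (level y n p) with h | h
        · exact .inl ⟨h1, h, h2⟩
        · exact .inr ⟨h1, h⟩
    · rw [Finset.disjoint_left]
      intro p hp hp'
      simp only [Finset.mem_filter] at hp hp'
      omega
  omega

end Level

/-! ### Cells -/

section Cells

variable {n : ℕ} (D : Data n) (time : Fin n → ℝ)

/-- The point with number `p` belongs to the slab that is bounded by the vertical lines through
the points `i` and `j`, from the time of the point `h` on. -/
def Data.InSlab (h i j p : ℕ) : Prop :=
  toArray time h ≤ toArray time p ∧
    toArray (fun p => (D.pts p).1) i ≤ toArray (fun p => (D.pts p).1) p ∧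
    toArray (fun p => (D.pts p).1) p ≤ toArray (fun p => (D.pts p).1) j

/-- The level of the point with number `p` with respect to the second coordinate. -/
noncomputable def Data.ylevel (p : ℕ) : ℕ := level (toArray fun p => (D.pts p).2) n p

/-- The points of a slab with level in `[u, q)`. -/
def Data.cell (h i j u q : ℕ) : Set (Fin n) :=
  {p | D.InSlab time h i j p ∧ u ≤ D.ylevel p ∧ D.ylevel p < q}

/-- The total weight of the points of a slab with level below `q`. -/
noncomputable def Data.below (h i j : ℕ) (w : Fin n → ℝ) (q : ℕ) : ℝ :=
  open Classical in
  ∑ p ∈ Finset.range n, if D.InSlab time h i j p ∧ D.ylevel p < q then toArray w p else 0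

/-- The total weight of those points of a slab, among the first `k` points, whose level is
`q - 1`. -/
noncomputable def Data.bucket (h i j : ℕ) (w : Fin n → ℝ) (k q : ℕ) : ℝ :=
  open Classical in
  ∑ p ∈ Finset.range k, if D.InSlab time h i j p ∧ D.ylevel p + 1 = q then toArray w p else 0

/-- The number `v` of points has a level below `v`. This holds for the cells that arise
from rectangles, with `v` the number of points not above the upper edge. -/
def Data.Tight (v : ℕ) : Prop :=
  v ≤ n ∧ ((Finset.range n).filter (D.ylevel · < v)).card = v

@[simp] theorem toArray_val (w : Fin n → ℝ) (p : Fin n) : toArray w p = w p := by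
  simp [toArray]

theorem sum_range_toArray (w : Fin n → ℝ) : ∑ p ∈ Finset.range n, toArray w p = ∑ p, w p := by
  rw [Finset.sum_range]; simp

variable {D time}

theorem Data.ylevel_lt {p : ℕ} (hp : p < n) : D.ylevel p < n := level_lt hp

theorem Data.cell_mono {h i j u u' q q' : ℕ} (hu : u' ≤ u) (hq : q ≤ q') :
    D.cell time h i j u q ⊆ D.cell time h i j u' q' :=
  fun _ hp => ⟨hp.1, hu.trans hp.2.1, hp.2.2.trans_le hq⟩

theorem Data.fraction_cell {h i j u q : ℕ} (huq : u ≤ q) (w : Fin n → ℝ) :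
    fraction w (D.cell time h i j u q) =
      (D.below time h i j w q - D.below time h i j w u) / ∑ p, w p := by
  classical
  unfold fraction Data.below
  rw [← Finset.sum_sub_distrib, Finset.sum_range]
  congr 1
  refine Finset.sum_congr rfl fun p _ => ?_
  rw [Set.indicator_apply, toArray_val]
  simp only [Data.cell, Set.mem_ofPred_eq]
  by_cases h1 : D.InSlab time h i j p
  · by_cases h2 : D.ylevel p < q
    · by_cases h3 : D.ylevel p < u
      · simp [h1, h2, h3, h3.not_ge]
      · simp [h1, h2, h3, not_lt.1 h3]
    · have h3 : ¬ D.ylevel p < u := by omega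
      simp [h1, h2, h3]
  · simp [h1]

theorem Data.below_zero (h i j : ℕ) (w : Fin n → ℝ) : D.below time h i j w 0 = 0 := by
  simp [Data.below]

theorem Data.below_succ (h i j : ℕ) (w : Fin n → ℝ) (q : ℕ) :
    D.below time h i j w (q + 1) = D.below time h i j w q + D.bucket time h i j w n (q + 1) := by
  classical
  unfold Data.below Data.bucket
  rw [← Finset.sum_add_distrib]
  refine Finset.sum_congr rfl fun p _ => ?_
  by_cases h1 : D.InSlab time h i j p
  · rcases lt_trichotomy (D.ylevel p) q with h | h | h
    · simp [h1, h, h.ne, h.trans (Nat.lt_succ_self q)]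
    · simp [h1, h]
    · simp [h1, h.not_gt, h.ne', show ¬ D.ylevel p < q + 1 by omega]
  · simp [h1]

theorem Data.bucket_zero_right (h i j : ℕ) (w : Fin n → ℝ) (k : ℕ) :
    D.bucket time h i j w k 0 = 0 := by
  simp [Data.bucket]

theorem Data.bucket_succ_of_inSlab {h i j k : ℕ} (hk : D.InSlab time h i j k) (w : Fin n → ℝ)
    (q : ℕ) : D.bucket time h i j w (k + 1) q =
      if q = D.ylevel k + 1 then D.bucket time h i j w k q + toArray w k
      else D.bucket time h i j w k q := by
  unfold Data.bucket
  rw [Finset.sum_range_succ]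
  by_cases h : q = D.ylevel k + 1
  · simp [hk, h]
  · simp [hk, h, Ne.symm h]

theorem Data.bucket_succ_of_not_inSlab {h i j k : ℕ} (hk : ¬ D.InSlab time h i j k)
    (w : Fin n → ℝ) (q : ℕ) : D.bucket time h i j w (k + 1) q = D.bucket time h i j w k q := by
  simp [Data.bucket, Finset.sum_range_succ, hk]

/-- Rounding the upper end of a tight cell down by less than `s` removes fewer than `s` points. -/
theorem Data.ncard_cell_sdiff_lt {h i j u q v s : ℕ} (hqv : q ≤ v) (hvs : v < q + s)
    (hv : D.Tight v) :
    (D.cell time h i j u v \ D.cell time h i j u q).ncard < s := by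
  refine lt_of_le_of_lt ?_ (card_level_mem_Ico_lt hqv hvs hv.1 hv.2)
  rw [← Set.ncard_coe_finset, ← Set.ncard_image_of_injective _ Fin.val_injective]
  refine Set.ncard_le_ncard ?_ (Finset.finite_toSet _)
  rintro _ ⟨p, ⟨hp, hp'⟩, rfl⟩
  simp only [Finset.coe_filter, Finset.mem_range, Set.mem_ofPred_eq]
  refine ⟨p.2, ?_, hp.2.2⟩
  by_contra! h'
  exact hp' ⟨hp.1, hp.2.1, h'⟩

/-- Every nonempty prospective region contains the same points as some tight cell. -/
theorem Data.exists_cell_eq_inWindow (T : Rect × ℝ) (hne : (D.inWindow time T).Nonempty) :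
    ∃ h i j u v : ℕ, h < n ∧ i < n ∧ j < n ∧ u < n ∧ D.Tight v ∧
      D.inWindow time T = D.cell time h i j u v := by
  classical
  obtain ⟨h, hh, hmin⟩ := Set.exists_min_image _ time (Set.toFinite _) hne
  obtain ⟨i, hi, himin⟩ := Set.exists_min_image _ (fun p => (D.pts p).1) (Set.toFinite _) hne
  obtain ⟨j, hj, hjmax⟩ := Set.exists_max_image _ (fun p => (D.pts p).1) (Set.toFinite _) hne
  obtain ⟨a, ha, hamin⟩ := Set.exists_min_image _ (fun p => (D.pts p).2) (Set.toFinite _) hne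
  obtain ⟨e, he, hemax⟩ := Set.exists_max_image _ (fun p => (D.pts p).2) (Set.toFinite _) hne
  set y := toArray fun p => (D.pts p).2 with hy
  set v := ((Finset.range n).filter (y · ≤ y e)).card with hv
  have hlev : ∀ p : ℕ, p < n → (D.ylevel p < v ↔ y p ≤ y e) := fun p hp => level_lt_card_le hp
  refine ⟨h, i, j, D.ylevel a, v, h.2, i.2, j.2, level_lt a.2, ⟨?_, ?_⟩, ?_⟩
  · exact (Finset.card_filter_le _ _).trans (Finset.card_range n).le
  · conv_rhs => rw [hv]
    congr 1
    refine Finset.filter_congr fun p hp => hlev p (Finset.mem_range.1 hp)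
  · ext p
    have h1 : D.ylevel a ≤ D.ylevel p ↔ (D.pts a).2 ≤ (D.pts p).2 := by
      refine (level_le_level_iff p.2).trans ?_
      simp
    have h2 : D.ylevel p < v ↔ (D.pts p).2 ≤ (D.pts e).2 := by
      refine (hlev p p.2).trans ?_
      simp [hy]
    simp only [Data.cell, Data.InSlab, Set.mem_ofPred_eq, toArray_val, h1, h2]
    constructor
    · intro hp
      exact ⟨⟨hmin p hp, himin p hp, hjmax p hp⟩, hamin p hp, hemax p hp⟩
    · rintro ⟨⟨p1, p2, p3⟩, p4, p5⟩
      simp only [Data.inWindow, Rect.toSet, Set.mem_ofPred_eq, Set.mem_prod, Set.mem_Icc]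
        at hh hi hj ha he ⊢
      exact ⟨⟨⟨hi.1.1.1.trans p2, p3.trans hj.1.1.2⟩, ha.1.2.1.trans p4, p5.trans he.1.2.2⟩,
        hh.2.trans p1⟩

/-- A cell is cut out by the rectangle whose lower and upper edges pass through the lowest point
of level at least `u` and the highest point of level below `q`. -/
theorem Data.inWindow_eq_cell {h i j u q a e : ℕ} (he : e < n)
    (hau : u ≤ D.ylevel a) (hmin : ∀ p < n, u ≤ D.ylevel p → D.ylevel a ≤ D.ylevel p)
    (heq : D.ylevel e < q) (hmax : ∀ p < n, D.ylevel p < q → D.ylevel p ≤ D.ylevel e) :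
    D.inWindow time (⟨toArray (fun p => (D.pts p).1) i, toArray (fun p => (D.pts p).1) j,
      toArray (fun p => (D.pts p).2) a, toArray (fun p => (D.pts p).2) e⟩, toArray time h) =
      D.cell time h i j u q := by
  ext p
  have h1 : u ≤ D.ylevel p ↔ toArray (fun p => (D.pts p).2) a ≤ (D.pts p).2 := by
    refine ⟨fun h => ?_, fun h => hau.trans (level_mono ?_)⟩
    · have := (level_le_level_iff p.2).1 (hmin p p.2 h)
      rwa [toArray_val (fun p => (D.pts p).2) p] at this
    · rwa [toArray_val (fun p => (D.pts p).2) p]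
  have h2 : D.ylevel p < q ↔ (D.pts p).2 ≤ toArray (fun p => (D.pts p).2) e := by
    refine ⟨fun h => ?_, fun h => (level_mono ?_).trans_lt heq⟩
    · have := (level_le_level_iff he).1 (hmax p p.2 h)
      rwa [toArray_val (fun p => (D.pts p).2) p] at this
    · rwa [toArray_val (fun p => (D.pts p).2) p]
  simp only [Data.cell, Data.InSlab, Data.inWindow, Rect.toSet, Set.mem_ofPred_eq, Set.mem_prod,
    Set.mem_Icc, h1, h2, toArray_val]
  tauto

end Cells

attribute [simp] run_skip_iff run_setNat_iff run_setReal_iff run_putNat_iff run_putReal_iff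
  run_seq_iff run_branch_iff NatExpr.eval NatExpr.cost RealExpr.eval RealExpr.cost Test.holds
  Test.cost

/-! ### Memory layout -/

section Layout

variable {n : ℕ} (D : Data n) (time : Fin n → ℝ) (c C : ℝ)

/-- The part of the input that stays in memory until the output is written. -/
structure Loaded (s : State) : Prop where
  n_eq : s.natVar 0 = n
  c_eq : s.realVar 1 = c
  C_eq : s.realVar 2 = C
  x_eq : s.realArr 0 = toArray fun p => (D.pts p).1
  y_eq : s.realArr 1 = toArray fun p => (D.pts p).2
  m_eq : s.realArr 2 = toArray D.m
  b_eq : s.realArr 3 = toArray D.b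
  t_eq : s.realArr 4 = toArray time

/-- The memory after preprocessing: natural registers `1` and `2` hold the number `H` of start
times and the step `d`; real registers `7`, `8` and `13` hold the two totals and the minimum
support; array `0` holds the levels. -/
structure Ready (H d : ℕ) (s : State) : Prop extends Loaded D time c C s where
  H_eq : s.natVar 1 = H
  d_eq : s.natVar 2 = d
  M_eq : s.realVar 7 = ∑ p, D.m p
  B_eq : s.realVar 8 = ∑ p, D.b p
  lo_eq : s.realVar 13 = C / n
  level_eq : ∀ p < n, s.natArr 0 p = D.ylevel p

/-- Natural registers `3`, `4`, `5` name a slab, and real arrays `5` and `6` hold its prefix sums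
in the order of the levels. -/
structure Filled (h i j : ℕ) (s : State) : Prop where
  h_eq : s.natVar 3 = h
  i_eq : s.natVar 4 = i
  j_eq : s.natVar 5 = j
  m_eq : ∀ q ≤ n, s.realArr 5 q = D.below time h i j D.m q
  b_eq : ∀ q ≤ n, s.realArr 6 q = D.below time h i j D.b q

/-- The record is truthful: if register `12` says that a region has been recorded, then registers
`13` to `17` name an admissible cell, and real register `17` is its discrepancy. -/
def Sound (s : State) : Prop :=
  0 < s.natVar 12 →
    D.Supported C (D.cell time (s.natVar 13) (s.natVar 14) (s.natVar 15) (s.natVar 16)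
      (s.natVar 17)) ∧
    s.realVar 17 = D.disc c (D.cell time (s.natVar 13) (s.natVar 14) (s.natVar 15) (s.natVar 16)
      (s.natVar 17))

/-- A region has been recorded, and its discrepancy is at least `z`. -/
def Covers (s : State) (z : ℝ) : Prop := 0 < s.natVar 12 ∧ z ≤ s.realVar 17

variable {D time c C}

theorem Loaded.frame {P : Prog} {s s' : State} (h : Loaded D time c C s) (hf : Frame P s s')
    (h₁ : 0 ∉ P.natWrites := by decide) (h₂ : ∀ i ∈ [1, 2], i ∉ P.realWrites := by decide)
    (h₃ : ∀ i ∈ [0, 1, 2, 3, 4], i ∉ P.realArrWrites := by decide) :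
    Loaded D time c C s' where
  n_eq := (hf.nat 0 h₁).trans h.n_eq
  c_eq := (hf.real 1 (h₂ _ (by simp))).trans h.c_eq
  C_eq := (hf.real 2 (h₂ _ (by simp))).trans h.C_eq
  x_eq := (hf.realArr 0 (h₃ _ (by simp))).trans h.x_eq
  y_eq := (hf.realArr 1 (h₃ _ (by simp))).trans h.y_eq
  m_eq := (hf.realArr 2 (h₃ _ (by simp))).trans h.m_eq
  b_eq := (hf.realArr 3 (h₃ _ (by simp))).trans h.b_eq
  t_eq := (hf.realArr 4 (h₃ _ (by simp))).trans h.t_eq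

theorem Ready.frame {P : Prog} {s s' : State} {H d : ℕ} (h : Ready D time c C H d s)
    (hf : Frame P s s') (h₁ : ∀ i ∈ [0, 1, 2], i ∉ P.natWrites := by decide)
    (h₂ : ∀ i ∈ [1, 2, 7, 8, 13], i ∉ P.realWrites := by decide)
    (h₃ : ∀ i ∈ [0, 1, 2, 3, 4], i ∉ P.realArrWrites := by decide)
    (h₄ : 0 ∉ P.natArrWrites := by decide) :
    Ready D time c C H d s' where
  toLoaded := h.toLoaded.frame hf (h₁ _ (by simp))
    (fun i hi => h₂ i (by simp only [List.mem_cons, List.not_mem_nil] at hi ⊢; tauto)) h₃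
  H_eq := (hf.nat 1 (h₁ _ (by simp))).trans h.H_eq
  d_eq := (hf.nat 2 (h₁ _ (by simp))).trans h.d_eq
  M_eq := (hf.real 7 (h₂ _ (by simp))).trans h.M_eq
  B_eq := (hf.real 8 (h₂ _ (by simp))).trans h.B_eq
  lo_eq := (hf.real 13 (h₂ _ (by simp))).trans h.lo_eq
  level_eq p hp := by rw [hf.natArr 0 h₄]; exact h.level_eq p hp

theorem Filled.frame {P : Prog} {s s' : State} {h i j : ℕ} (hs : Filled D time h i j s)
    (hf : Frame P s s') (h₁ : ∀ i ∈ [3, 4, 5], i ∉ P.natWrites := by decide)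
    (h₂ : ∀ i ∈ [5, 6], i ∉ P.realArrWrites := by decide) :
    Filled D time h i j s' where
  h_eq := (hf.nat 3 (h₁ _ (by simp))).trans hs.h_eq
  i_eq := (hf.nat 4 (h₁ _ (by simp))).trans hs.i_eq
  j_eq := (hf.nat 5 (h₁ _ (by simp))).trans hs.j_eq
  m_eq q hq := by rw [hf.realArr 5 (h₂ _ (by simp))]; exact hs.m_eq q hq
  b_eq q hq := by rw [hf.realArr 6 (h₂ _ (by simp))]; exact hs.b_eq q hq

theorem Sound.frame {P : Prog} {s s' : State} (hs : Sound D time c C s)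
    (hf : Frame P s s') (h₁ : ∀ i ∈ [12, 13, 14, 15, 16, 17], i ∉ P.natWrites := by decide)
    (h₂ : 17 ∉ P.realWrites := by decide) : Sound D time c C s' := by
  unfold Sound
  rw [hf.nat 12 (h₁ _ (by simp)), hf.nat 13 (h₁ _ (by simp)), hf.nat 14 (h₁ _ (by simp)),
    hf.nat 15 (h₁ _ (by simp)), hf.nat 16 (h₁ _ (by simp)), hf.nat 17 (h₁ _ (by simp)),
    hf.real 17 h₂]
  exact hs

theorem Covers.frame {P : Prog} {s s' : State} {z : ℝ} (hs : Covers s z)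
    (hf : Frame P s s') (h₁ : 12 ∉ P.natWrites := by decide)
    (h₂ : 17 ∉ P.realWrites := by decide) : Covers s' z := by
  unfold Covers
  rw [hf.nat 12 h₁, hf.real 17 h₂]
  exact hs

end Layout

/-! ### Scanning one slab -/

/-- The fraction carried by the points with level between register `6` (inclusive) and register
`q` (exclusive), from the prefix sums in array `a` and the total in real register `W`. -/
def fracExpr (a W q : ℕ) : RealExpr :=
  .div (.sub (.get a (.var q)) (.get a (.var 6))) (.var W)

/-- Record the current cell together with the value in real register `16`. -/
def record : Prog :=
  .seq (.setNat 12 (.lit 1)) <| .seq (.setNat 13 (.var 3)) <| .seq (.setNat 14 (.var 4)) <|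
  .seq (.setNat 15 (.var 5)) <| .seq (.setNat 16 (.var 6)) <| .seq (.setNat 17 (.var 8)) <|
  .setReal 17 (.var 16)

/-- Compute the discrepancy of the current cell, and record it if it is the largest so far. -/
def compareDisc : Prog :=
  .seq (.setReal 16 (.div (.mul (.var 1) (.mul (.sub (.var 14) (.var 15))
    (.sub (.var 14) (.var 15)))) (.mul (.var 15) (.sub (.lit 1) (.var 15))))) <|
  .branch (.neg (.conj (.natLt (.lit 0) (.var 12)) (.neg (.realLt (.var 17) (.var 16)))))
    record .skip

/-- Examine the cell with levels in `[u, q)`, where `u` and `q` are in registers `6` and `8`, and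
move `q` up by the step. -/
def tryCell : Prog :=
  .seq (.setReal 14 (fracExpr 5 7 8)) <| .seq (.setReal 15 (fracExpr 6 8 8)) <|
  .seq (.branch (.conj (.neg (.realLt (.sub (.lit 1) (.var 13)) (.var 14)))
      (.neg (.realLt (.sub (.lit 1) (.var 13)) (.var 15)))) compareDisc .skip) <|
  .setNat 8 (.add (.var 8) (.var 2))

section Scan

variable {n : ℕ} {D : Data n} {time : Fin n → ℝ} {c C : ℝ}

theorem run_record {s : State} {z : ℝ} (hz : s.realVar 16 = z)
    (h1 : D.Supported C (D.cell time (s.natVar 3) (s.natVar 4) (s.natVar 5) (s.natVar 6)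
      (s.natVar 8)))
    (h2 : z = D.disc c (D.cell time (s.natVar 3) (s.natVar 4) (s.natVar 5) (s.natVar 6)
      (s.natVar 8))) :
    Run record s fun t s' => t ≤ 14 ∧ Sound D time c C s' ∧ 0 < s'.natVar 12 ∧
      s'.realVar 17 = z := by
  subst hz
  simp [record, Sound, h1, ← h2]

theorem run_compareDisc {s : State} (hc : s.realVar 1 = c) (hs : Sound D time c C s)
    (hm : s.realVar 14 = fraction D.m (D.cell time (s.natVar 3) (s.natVar 4) (s.natVar 5)
      (s.natVar 6) (s.natVar 8)))
    (hb : s.realVar 15 = fraction D.b (D.cell time (s.natVar 3) (s.natVar 4) (s.natVar 5)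
      (s.natVar 6) (s.natVar 8)))
    (h1 : D.Supported C (D.cell time (s.natVar 3) (s.natVar 4) (s.natVar 5) (s.natVar 6)
      (s.natVar 8))) :
    Run compareDisc s fun t s' => t ≤ 40 ∧ Sound D time c C s' ∧
      (∀ z, Covers s z → Covers s' z) ∧
      Covers s' (D.disc c (D.cell time (s.natVar 3) (s.natVar 4) (s.natVar 5) (s.natVar 6)
        (s.natVar 8))) := by
  rw [compareDisc, run_seq_iff, run_setReal_iff]
  have hval : ∀ S, s.realVar 14 = fraction D.m S → s.realVar 15 = fraction D.b S →
      s.realVar 1 * ((s.realVar 14 - s.realVar 15) * (s.realVar 14 - s.realVar 15)) /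
        (s.realVar 15 * ((1 : ℕ) - s.realVar 15)) = D.disc c S := by
    intro S h h'
    rw [h, h', hc, Data.disc, dG, pow_two, Nat.cast_one]
  specialize hval _ hm hb
  simp only [RealExpr.eval, hval]
  have hs' : Sound D time c C { s with realVar := Function.update s.realVar 16 (D.disc c (D.cell
      time (s.natVar 3) (s.natVar 4) (s.natVar 5) (s.natVar 6) (s.natVar 8))) } := by
    simpa [Sound, Function.update_apply] using hs
  rw [run_branch_iff]
  constructor
  · intro hb
    refine Run.mono (run_record (c := c) (s := { s with
      realVar := Function.update s.realVar 16 _ }) (by simp) h1 rfl) ?_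
    rintro t s' ⟨ht, hS, h12, h17⟩
    refine ⟨by simp; omega, hS, fun z hz => ⟨h12, ?_⟩, h12, h17.ge⟩
    simp at hb
    rw [h17]
    exact hz.2.trans (hb hz.1).le
  · intro hb
    simp at hb
    rw [run_skip_iff]
    refine ⟨by simp, hs', fun z hz => ?_, ?_⟩
    · simpa [Covers, Function.update_apply] using hz
    · simpa [Covers, Function.update_apply] using hb

theorem run_tryCell {s : State} {H d h i j u q : ℕ} (hr : Ready D time c C H d s)
    (hf : Filled D time h i j s) (hs : Sound D time c C s) (hu : s.natVar 6 = u)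
    (hq : s.natVar 8 = q) (huq : u ≤ q) (hqn : q ≤ n)
    (hlow : C / n ≤ fraction D.m (D.cell time h i j u q) ∧
      C / n ≤ fraction D.b (D.cell time h i j u q)) :
    Run tryCell s fun t s' => t ≤ 75 ∧ s'.natVar 8 = q + d ∧ Sound D time c C s' ∧
      (∀ z, Covers s z → Covers s' z) ∧
      (D.Supported C (D.cell time h i j u q) →
        Covers s' (D.disc c (D.cell time h i j u q))) := by
  obtain ⟨hh, hi, hj, hM, hB⟩ := hf
  have e1 : (s.realArr 5 q - s.realArr 5 u) / s.realVar 7 =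
      fraction D.m (D.cell time h i j u q) := by
    rw [Data.fraction_cell huq, hM q hqn, hM u (huq.trans hqn), hr.M_eq]
  have e2 : (s.realArr 6 q - s.realArr 6 u) / s.realVar 8 =
      fraction D.b (D.cell time h i j u q) := by
    rw [Data.fraction_cell huq, hB q hqn, hB u (huq.trans hqn), hr.B_eq]
  rw [tryCell]
  simp only [run_seq_iff, run_setReal_iff, fracExpr, RealExpr.eval, NatExpr.eval, hu, hq, e1]
  simp only [Function.update_apply, Nat.reduceEqDiff, if_false, e2]
  set s' : State := { s with
    realVar := Function.update (Function.update s.realVar 14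
      (fraction D.m (D.cell time h i j u q))) 15 (fraction D.b (D.cell time h i j u q)) } with hs'
  have hs'' : Sound D time c C s' := by simpa [hs', Sound, Function.update_apply] using hs
  have hC : ∀ z, Covers s z → Covers s' z := fun z hz => by
    simpa [hs', Covers, Function.update_apply] using hz
  have hn8 : s'.natVar 8 = q := hq
  have hn2 : s'.natVar 2 = d := hr.d_eq
  rw [run_branch_iff]
  constructor
  · intro hb
    simp [hs', hr.lo_eq] at hb
    have hS : D.Supported C (D.cell time h i j u q) := ⟨⟨hlow.1, hb.1⟩, hlow.2, hb.2⟩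
    refine ((run_compareDisc (s := s') (D := D) (time := time) (c := c) (C := C) ?_ hs''
      ?_ ?_ ?_).frame).mono ?_
    · simp [hs', hr.c_eq]
    · simp [hs', hh, hi, hj, hu, hq]
    · simp [hs', hh, hi, hj, hu, hq]
    · simpa [hs', hh, hi, hj, hu, hq, Function.update_apply] using hS
    · rintro t s'' ⟨hf, ht, hS', hz, hcov⟩
      simp only [hs', hh, hi, hj, hu, hq] at hcov
      rw [run_setNat_iff]
      refine ⟨?_, ?_, ?_, fun z hzz => ?_, fun _ => ?_⟩
      · simp; omega
      · simp [hf.nat 8 (by decide), hf.nat 2 (by decide), hn8, hn2]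
      · simpa [Sound, Function.update_apply] using hS'
      · simpa [Covers, Function.update_apply] using hz z (hC z hzz)
      · simpa [Covers, Function.update_apply] using hcov
  · intro hb
    rw [run_skip_iff, run_setNat_iff]
    refine ⟨?_, ?_, ?_, fun z hzz => ?_, fun hS => ?_⟩
    · simp
    · simp [hn8, hn2]
    · simpa [Sound, Function.update_apply] using hs''
    · simpa [Covers, Function.update_apply] using hC z hzz
    · refine absurd ?_ hb
      simpa [hs', hr.lo_eq, Function.update_apply] using And.intro hS.1.2 hS.2.2

end Scan

/-- Examine every `d`-th cell `[u, q)`, where `u` is in register `6` and `q` starts at the content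
of register `8`. -/
def scanCells : Prog := .loop (.natLt (.var 8) (.add (.var 0) (.lit 1))) tryCell

/-- Test whether the cell `[u, q)`, with `u` and `q` in registers `6` and `7`, has minimum
support. -/
def lowTest : Test :=
  .conj (.neg (.realLt (fracExpr 5 7 7) (.var 13))) (.neg (.realLt (fracExpr 6 8 7) (.var 13)))

/-- One round of the sweep over `u`: either advance the least supported `q`, or scan from there
and advance `u`. -/
def sweepRound : Prog :=
  .branch (.conj (.natLt (.var 7) (.add (.var 0) (.lit 1))) (.neg lowTest))
    (.setNat 7 (.add (.var 7) (.lit 1)))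
    (.seq (.setNat 8 (.var 7)) <| .seq scanCells <| .setNat 6 (.add (.var 6) (.lit 1)))

/-- Examine the cells of the current slab. -/
def sweep : Prog :=
  .seq (.setNat 6 (.lit 0)) <| .seq (.setNat 7 (.lit 0)) <|
    .loop (.natLt (.var 6) (.var 0)) sweepRound

section Sweep

variable {n : ℕ} {D : Data n} {time : Fin n → ℝ} {c C : ℝ}

/-- Both fractions of `S` reach the lower bound of the minimum support. -/
def Data.Low (D : Data n) (C : ℝ) (S : Set (Fin n)) : Prop :=
  C / n ≤ fraction D.m S ∧ C / n ≤ fraction D.b S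

/-- Removing fewer than `d` points from an admissible region costs at most `ε`, unless it
violates the minimum support. -/
def Data.StepOK (D : Data n) (c C ε : ℝ) (d : ℕ) : Prop :=
  ∀ S S' : Set (Fin n), S' ⊆ S → D.Supported C S → D.Supported C S' → (S \ S').ncard < d →
    D.disc c S ≤ D.disc c S' + ε

theorem Data.Low.mono {κ₁ κ₂ : ℝ} (hκ : 0 < κ₁) (hD : D.Bounded κ₁ κ₂) {S S' : Set (Fin n)}
    (h : S ⊆ S') (hS : D.Low C S) : D.Low C S' :=
  ⟨hS.1.trans (fraction_mono (fun p => hκ.le.trans (hD p).1.1) h),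
    hS.2.trans (fraction_mono (fun p => hκ.le.trans (hD p).2.1) h)⟩

theorem Data.Low.nonempty (hC : 0 < C) (hn : 0 < n) {S : Set (Fin n)} (hS : D.Low C S) :
    S.Nonempty := by
  by_contra! h
  have : 0 < C / n := by positivity
  have h1 := hS.1
  rw [h] at h1
  simp [fraction] at h1
  linarith

theorem Data.Low.lt (hC : 0 < C) (hn : 0 < n) {h i j u q : ℕ}
    (hS : D.Low C (D.cell time h i j u q)) : u < q :=
  let ⟨_, hp⟩ := hS.nonempty hC hn
  hp.2.1.trans_lt hp.2.2

theorem Data.Supported.of_subset {κ₁ κ₂ : ℝ} (hκ : 0 < κ₁) (hD : D.Bounded κ₁ κ₂)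
    {S S' : Set (Fin n)} (h : S ⊆ S') (hS : D.Low C S) (hS' : D.Supported C S') :
    D.Supported C S :=
  ⟨⟨hS.1, (fraction_mono (fun p => hκ.le.trans (hD p).1.1) h).trans hS'.1.2⟩,
    hS.2, (fraction_mono (fun p => hκ.le.trans (hD p).2.1) h).trans hS'.2.2⟩

theorem run_scanCells {s : State} {H d h i j u q₀ : ℕ} (hr : Ready D time c C H d s)
    (hf : Filled D time h i j s) (hs : Sound D time c C s) (hu : s.natVar 6 = u)
    (hq : s.natVar 8 = q₀) (huq : u ≤ q₀) (hd : 0 < d)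
    (hlow : ∀ q, q₀ ≤ q → q ≤ n → D.Low C (D.cell time h i j u q)) :
    Run scanCells s fun t s' => t ≤ 80 * (n / d + 1) + 5 ∧ Sound D time c C s' ∧
      (∀ z, Covers s z → Covers s' z) ∧
      ∀ k, q₀ + k * d ≤ n → D.Supported C (D.cell time h i j u (q₀ + k * d)) →
        Covers s' (D.disc c (D.cell time h i j u (q₀ + k * d))) := by
  refine (Run.loop_frame (fun s' => Sound D time c C s' ∧ (∀ z, Covers s z → Covers s' z) ∧
    ∃ k, s'.natVar 8 = q₀ + k * d ∧ ∀ k' < k,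
      D.Supported C (D.cell time h i j u (q₀ + k' * d)) →
        Covers s' (D.disc c (D.cell time h i j u (q₀ + k' * d))))
    (fun s' => 80 * ((n + d - s'.natVar 8) / d)) ?_ ?_).mono ?_
  · rintro s' hfr ⟨hS, hz, k, hk, hcov⟩ hb
    have hn' : s'.natVar 0 = n := (hfr.nat 0 (by decide)).trans hr.n_eq
    simp only [Test.holds, NatExpr.eval, hn', hk] at hb
    have hle : q₀ + k * d ≤ n := by omega
    refine (run_tryCell (hr.frame hfr) (hf.frame hfr) hS ((hfr.nat 6 (by decide)).trans hu) hk
      (by omega) hle (hlow _ (by omega) hle)).mono ?_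
    rintro t s'' ⟨ht, h8, hS', hz', hcov'⟩
    refine ⟨⟨hS', fun z h => hz' z (hz z h), k + 1, ?_, fun k' hk' hsup => ?_⟩, ?_⟩
    · rw [h8]; ring
    · rcases Nat.lt_succ_iff_lt_or_eq.1 hk' with h | rfl
      · exact hz' _ (hcov k' h hsup)
      · exact hcov' hsup
    · simp only [h8, hk, Test.cost, NatExpr.cost]
      obtain ⟨a, ha⟩ : ∃ a, n = q₀ + k * d + a := ⟨_, (Nat.add_sub_cancel' hle).symm⟩
      rw [show n + d - (q₀ + k * d + d) = a by omega,
        show n + d - (q₀ + k * d) = a + d by omega, Nat.add_div_right _ hd]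
      omega
  · exact ⟨hs, fun z h => h, 0, by simpa using hq, by simp⟩
  · rintro t s' ⟨hfr, ⟨hS, hz, k, hk, hcov⟩, hb, ht⟩
    have hn' : s'.natVar 0 = n := (hfr.nat 0 (by decide)).trans hr.n_eq
    simp only [Test.holds, NatExpr.eval, hn', hk] at hb
    refine ⟨?_, hS, hz, fun k' hk' => hcov k' ?_⟩
    · have h1 : (n + d - s.natVar 8) / d ≤ (n + d) / d := Nat.div_le_div_right (Nat.sub_le _ _)
      rw [Nat.add_div_right _ hd] at h1
      simp only [Test.cost, NatExpr.cost] at ht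
      omega
    · by_contra! hkk
      have := Nat.mul_le_mul_right d hkk
      omega

/-- Tight cells are covered up to `ε`: if the cells with upper level `q₀ + k d` have been
examined, one of them arises from a given tight cell by removing fewer than `d` points. -/
theorem covers_of_tight {s : State} {κ₁ κ₂ ε : ℝ} (hκ : 0 < κ₁) (hD : D.Bounded κ₁ κ₂)
    {d h i j u v q₀ : ℕ} (hd : 0 < d) (hstep : D.StepOK c C ε d) (hqv : q₀ ≤ v)
    (hv : D.Tight v) (hsup : D.Supported C (D.cell time h i j u v))
    (hlow : ∀ q, q₀ ≤ q → q ≤ n → D.Low C (D.cell time h i j u q))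
    (hcov : ∀ k, q₀ + k * d ≤ n → D.Supported C (D.cell time h i j u (q₀ + k * d)) →
        Covers s (D.disc c (D.cell time h i j u (q₀ + k * d)))) :
    Covers s (D.disc c (D.cell time h i j u v) - ε) := by
  set k := (v - q₀) / d with hk
  have h1 : k * d ≤ v - q₀ := Nat.div_mul_le_self _ _
  have h2 : v - q₀ < k * d + d := by
    have := Nat.lt_mul_div_succ (v - q₀) hd
    rw [← hk] at this
    linarith [mul_comm d (k + 1), Nat.succ_mul k d]
  have hle : q₀ + k * d ≤ v := by omega
  have hsub : D.cell time h i j u (q₀ + k * d) ⊆ D.cell time h i j u v :=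
    Data.cell_mono le_rfl hle
  have hsup' := Data.Supported.of_subset hκ hD hsub
    (hlow _ (Nat.le_add_right _ _) (hle.trans hv.1)) hsup
  have h3 := hcov k (hle.trans hv.1) hsup'
  have h4 := hstep _ _ hsub hsup hsup' (Data.ncard_cell_sdiff_lt hle (by omega) hv)
  exact ⟨h3.1, by linarith [h3.2]⟩

/-- The sweep covers all tight cells of a slab up to `ε`. Between two rounds no cell `[u, q)` with
`q` below register `7` reaches the lower bound; this survives an increase of `u`, which only
removes points, so register `7` never moves back and its total movement costs `O(n)`. -/
theorem run_sweep {s : State} {κ₁ κ₂ ε : ℝ} (hκ : 0 < κ₁) (hD : D.Bounded κ₁ κ₂) (hC : 0 < C)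
    {H d h i j : ℕ} (hd : 0 < d) (hstep : D.StepOK c C ε d) (hr : Ready D time c C H d s)
    (hf : Filled D time h i j s) (hs : Sound D time c C s) :
    Run sweep s fun t s' => t ≤ n * (80 * (n / d + 1) + 100) + 50 * (n + 1) + 7 ∧
      Sound D time c C s' ∧ (∀ z, Covers s z → Covers s' z) ∧
      ∀ u < n, ∀ v, D.Tight v → D.Supported C (D.cell time h i j u v) →
        Covers s' (D.disc c (D.cell time h i j u v) - ε) := by
  rw [sweep, run_seq_iff, run_setNat_iff, run_seq_iff, run_setNat_iff]
  set J := n / d + 1 with hJ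
  set s₀ : State := { s with natVar := Function.update (Function.update s.natVar 6 0) 7 0 }
    with hs₀
  have hfr₀ : Frame (.seq (.setNat 6 (.lit 0)) (.setNat 7 (.lit 0))) s s₀ :=
    (Exec.setNat 6 (.lit 0) s |>.seq (Exec.setNat 7 (.lit 0) _)).frame
  refine (Run.loop_frame (fun s' => s'.natVar 6 ≤ n ∧ s'.natVar 6 ≤ s'.natVar 7 ∧
    s'.natVar 7 ≤ n + 1 ∧
    (∀ q < s'.natVar 7, ¬ D.Low C (D.cell time h i j (s'.natVar 6) q)) ∧
    Sound D time c C s' ∧ (∀ z, Covers s z → Covers s' z) ∧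
      ∀ u < s'.natVar 6, ∀ v, D.Tight v → D.Supported C (D.cell time h i j u v) →
        Covers s' (D.disc c (D.cell time h i j u v) - ε))
    (fun s' => (n - s'.natVar 6) * (80 * J + 100) + 50 * (n + 1 - s'.natVar 7))
    ?_ ?_).mono ?_
  · rintro s' hfr ⟨h6n, h67, h7, hq, hS, hz, hcov⟩ hb
    have hr' := (hr.frame hfr₀).frame hfr
    have hf' := (hf.frame hfr₀).frame hfr
    generalize hu : s'.natVar 6 = u at *
    generalize hq₀ : s'.natVar 7 = q₀ at *
    have hn' := hr'.n_eq
    simp only [Test.holds, NatExpr.eval, hn', hu] at hb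
    have hlow : ∀ q, s'.natVar 7 = q → u ≤ q → q ≤ n →
        (lowTest.holds s' ↔ D.Low C (D.cell time h i j u q)) := by
      intro q h7 huq hqn
      simp only [lowTest, fracExpr, Test.holds, RealExpr.eval, NatExpr.eval, hu, h7, not_lt,
        hr'.lo_eq, hr'.M_eq, hr'.B_eq, hf'.m_eq q hqn, hf'.b_eq q hqn,
        hf'.m_eq u (huq.trans hqn), hf'.b_eq u (huq.trans hqn), Data.Low,
        Data.fraction_cell huq]
    rw [sweepRound, run_branch_iff]
    constructor
    · rintro ⟨h1, h2⟩
      simp only [Test.holds, NatExpr.eval, hn', hq₀] at h1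
      replace h2 : ¬ lowTest.holds s' := h2
      rw [hlow q₀ hq₀ h67 (by omega)] at h2
      rw [run_setNat_iff]
      refine ⟨⟨?_, ?_, ?_, ?_, ?_, ?_, ?_⟩, ?_⟩
      · simpa [hu] using h6n
      · simp [hu, hq₀]; omega
      · simp [hq₀]; omega
      · intro q hqq
        simp only [NatExpr.eval, Function.update_self, hq₀] at hqq
        simp only [Function.update_apply, Nat.reduceEqDiff, if_false, hu]
        rcases Nat.lt_succ_iff_lt_or_eq.1 hqq with h | rfl
        · exact hq q h
        · exact h2
      · simpa [Sound] using hS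
      · simpa [Covers] using hz
      · simpa [Covers, hu] using hcov
      · simp [hu, hq₀, lowTest, fracExpr]
        omega
    · intro hnb
      have hlow₀ : ∀ q, q₀ ≤ q → q ≤ n → D.Low C (D.cell time h i j u q) := by
        intro q hq₀q hqn
        refine Data.Low.mono hκ hD (Data.cell_mono le_rfl hq₀q) ?_
        rw [← hlow q₀ hq₀ h67 (by omega)]
        by_contra h'
        refine hnb ⟨?_, h'⟩
        simp only [Test.holds, NatExpr.eval, hn', hq₀]
        omega
      rw [run_seq_iff, run_setNat_iff, run_seq_iff]
      have hfr₁ := (Exec.setNat 8 (.var 7) s').frame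
      refine (run_scanCells (hr'.frame hfr₁) (hf'.frame hfr₁) (hS.frame hfr₁)
        (u := u) (q₀ := q₀) (by simpa using hu) (by simpa using hq₀) h67 hd hlow₀).frame.mono ?_
      rintro t s'' ⟨hfr₂, ht, hS'', hz'', hcov''⟩
      have h6' : s''.natVar 6 = u := by rw [hfr₂.nat 6 (by decide)]; simpa using hu
      have h7' : s''.natVar 7 = q₀ := by rw [hfr₂.nat 7 (by decide)]; simpa using hq₀
      have hzz : ∀ z, Covers s' z → Covers s'' z := fun z h => hz'' z (h.frame hfr₁)
      have hltq : u < q₀ := by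
        rcases Nat.lt_or_ge n q₀ with h | h
        · omega
        · exact (hlow₀ q₀ le_rfl h).lt hC (by omega)
      rw [run_setNat_iff]
      refine ⟨⟨?_, ?_, ?_, ?_, ?_, ?_, ?_⟩, ?_⟩
      · simp [h6']; omega
      · simp [h6', h7']; omega
      · simpa [h7'] using h7
      · simp only [NatExpr.eval, Function.update_self, h6']
        simp only [Function.update_apply, Nat.reduceEqDiff, if_false, h7']
        exact fun q hqq h' => hq q hqq (h'.mono hκ hD (Data.cell_mono (Nat.le_succ u) le_rfl))
      · simpa [Sound] using hS''
      · simpa [Covers] using fun z h => hzz z (hz z h)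
      · intro u' hu' v hv hsup
        simp only [NatExpr.eval, Function.update_self, h6'] at hu'
        have : Covers s'' (D.disc c (D.cell time h i j u' v) - ε) := by
          rcases Nat.lt_succ_iff_lt_or_eq.1 hu' with h | rfl
          · exact hzz _ (hcov u' h v hv hsup)
          · refine covers_of_tight hκ hD hd hstep ?_ hv hsup hlow₀ hcov''
            by_contra! h'
            exact hq v h' ⟨hsup.1.1, hsup.2.1⟩
        simpa [Covers] using this
      · simp [h6', h7', lowTest, fracExpr]
        obtain ⟨a, ha⟩ : ∃ a, n - u = a + 1 := ⟨n - u - 1, by omega⟩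
        rw [ha, show n - (u + 1) = a by omega, Nat.add_one_mul a]
        omega
  · refine ⟨?_, ?_, ?_, ?_, ?_, ?_, ?_⟩
    · simp
    · simp
    · simp
    · simp
    · exact hs.frame hfr₀
    · exact fun z h => h.frame hfr₀
    · simp
  · rintro t s' ⟨hfr, ⟨h6n, h67, h7, hq, hS, hz, hcov⟩, hb, ht⟩
    have hn' := ((hr.frame hfr₀).frame hfr).n_eq
    simp only [Test.holds, NatExpr.eval, hn'] at hb
    refine ⟨?_, hS, hz, fun u hu => hcov u (by omega)⟩
    simp at ht
    simp
    omega

end Sweep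

/-! ### Prefix sums of a slab -/

/-- Set the cells `0, …, n` of the real arrays `5` and `6` to zero. -/
def clearSums : Prog :=
  .seq (.putReal 5 (.lit 0) (.lit 0)) <| .seq (.putReal 6 (.lit 0) (.lit 0)) <|
  .forLt 9 0 (.seq (.putReal 5 (.add (.var 9) (.lit 1)) (.lit 0))
    (.putReal 6 (.add (.var 9) (.lit 1)) (.lit 0)))

/-- Test whether the point in register `9` belongs to the slab in registers `3`, `4`, `5`. -/
def slabTest : Test :=
  .conj (.neg (.realLt (.get 4 (.var 9)) (.get 4 (.var 3)))) <|
  .conj (.neg (.realLt (.get 0 (.var 9)) (.get 0 (.var 4))))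
    (.neg (.realLt (.get 0 (.var 5)) (.get 0 (.var 9))))

/-- Add the weights of the points of the slab to the cells that belong to their levels. -/
def depositSums : Prog :=
  .forLt 9 0 <| .branch slabTest
    (.seq (.putReal 5 (.add (.get 0 (.var 9)) (.lit 1))
        (.add (.get 5 (.add (.get 0 (.var 9)) (.lit 1))) (.get 2 (.var 9))))
      (.putReal 6 (.add (.get 0 (.var 9)) (.lit 1))
        (.add (.get 6 (.add (.get 0 (.var 9)) (.lit 1))) (.get 3 (.var 9)))))
    .skip

/-- Replace the sums over single levels by prefix sums. -/
def accumulateSums : Prog :=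
  .forLt 9 0 <| .seq
    (.putReal 5 (.add (.var 9) (.lit 1))
      (.add (.get 5 (.var 9)) (.get 5 (.add (.var 9) (.lit 1)))))
    (.putReal 6 (.add (.var 9) (.lit 1))
      (.add (.get 6 (.var 9)) (.get 6 (.add (.var 9) (.lit 1)))))

/-- Compute the prefix sums of the current slab. -/
def fillSums : Prog := .seq clearSums <| .seq depositSums accumulateSums

section Fill

variable {n : ℕ} {D : Data n} {time : Fin n → ℝ} {c C : ℝ}

theorem run_clearSums {s : State} (hn : s.natVar 0 = n) :
    Run clearSums s fun t s' => t ≤ 20 * n + 15 ∧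
      ∀ q ≤ n, s'.realArr 5 q = 0 ∧ s'.realArr 6 q = 0 := by
  rw [clearSums, run_seq_iff, run_putReal_iff, run_seq_iff, run_putReal_iff]
  refine (Run.forLt (N := n) (T := 10)
    (fun k s' => ∀ q ≤ k, s'.realArr 5 q = 0 ∧ s'.realArr 6 q = 0) ?_ (by decide) (by decide)
    (by decide) ?_ ?_ ?_).mono ?_
  · simpa using hn
  · exact fun k s a h => h
  · simp
  · intro k s' hk hf h9 hI
    simp only [run_seq_iff, run_putReal_iff]
    refine ⟨by simp, fun q hq => ?_⟩
    rcases Nat.le_succ_iff.1 hq with h | rfl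
    · have : q ≠ k + 1 := by omega
      simpa [h9, this] using hI q h
    · simp [h9]
  · rintro t s' ⟨ht, hf, hI⟩
    refine ⟨?_, hI⟩
    simp
    omega

theorem slabTest_holds_iff {s : State} {h i j p : ℕ} (hr : Loaded D time c C s)
    (hh : s.natVar 3 = h) (hi : s.natVar 4 = i) (hj : s.natVar 5 = j) (hp : s.natVar 9 = p) :
    slabTest.holds s ↔ D.InSlab time h i j p := by
  simp only [slabTest, Test.holds, RealExpr.eval, NatExpr.eval, hh, hi, hj, hp, hr.x_eq, hr.t_eq,
    not_lt, Data.InSlab]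

theorem run_depositSums {s : State} {H d h i j : ℕ} (hr : Ready D time c C H d s)
    (hh : s.natVar 3 = h) (hi : s.natVar 4 = i) (hj : s.natVar 5 = j)
    (h0 : ∀ q ≤ n, s.realArr 5 q = 0 ∧ s.realArr 6 q = 0) :
    Run depositSums s fun t s' => t ≤ 67 * n + 5 ∧
      ∀ q ≤ n, s'.realArr 5 q = D.bucket time h i j D.m n q ∧
        s'.realArr 6 q = D.bucket time h i j D.b n q := by
  refine (Run.forLt (N := n) (T := 60)
    (fun k s' => ∀ q ≤ n, s'.realArr 5 q = D.bucket time h i j D.m k q ∧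
        s'.realArr 6 q = D.bucket time h i j D.b k q) hr.n_eq (by decide) (by decide)
    (by decide) ?_ ?_ ?_).mono ?_
  · exact fun k s a h => h
  · simpa [Data.bucket] using h0
  · intro k s' hk hf h9 hI
    have hr' := hr.frame hf
    rw [run_branch_iff, slabTest_holds_iff hr'.toLoaded ((hf.nat 3 (by decide)).trans hh)
      ((hf.nat 4 (by decide)).trans hi) ((hf.nat 5 (by decide)).trans hj) h9]
    constructor
    · intro hS
      simp only [run_seq_iff, run_putReal_iff]
      refine ⟨by simp [slabTest], fun q hq => ?_⟩
      rw [Data.bucket_succ_of_inSlab hS, Data.bucket_succ_of_inSlab hS]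
      have hg := hr'.level_eq k hk
      by_cases hqk : q = D.ylevel k + 1
      · subst hqk
        simp [h9, hg, hI _ hq, hr'.m_eq, hr'.b_eq]
      · simpa [h9, hg, hqk] using hI q hq
    · intro hS
      rw [run_skip_iff]
      refine ⟨by simp [slabTest], fun q hq => ?_⟩
      rw [Data.bucket_succ_of_not_inSlab hS, Data.bucket_succ_of_not_inSlab hS]
      exact hI q hq
  · rintro t s' ⟨ht, hf, hI⟩
    exact ⟨by omega, hI⟩

theorem run_accumulateSums {s : State} {h i j : ℕ} (hn : s.natVar 0 = n)
    (hb : ∀ q ≤ n, s.realArr 5 q = D.bucket time h i j D.m n q ∧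
        s.realArr 6 q = D.bucket time h i j D.b n q) :
    Run accumulateSums s fun t s' => t ≤ 37 * n + 5 ∧
      ∀ q ≤ n, s'.realArr 5 q = D.below time h i j D.m q ∧
        s'.realArr 6 q = D.below time h i j D.b q := by
  refine (Run.forLt (N := n) (T := 30)
    (fun k s' => ∀ q ≤ n,
      s'.realArr 5 q = (if q ≤ k then D.below time h i j D.m q
        else D.bucket time h i j D.m n q) ∧
      s'.realArr 6 q = (if q ≤ k then D.below time h i j D.b q
        else D.bucket time h i j D.b n q)) hn (by decide) (by decide)
    (by decide) ?_ ?_ ?_).mono ?_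
  · exact fun k s a h => h
  · intro q hq
    rw [(hb q hq).1, (hb q hq).2]
    rcases q.eq_zero_or_pos with rfl | h
    · simp [Data.below_zero, Data.bucket_zero_right]
    · simp [h.ne']
  · intro k s' hk hf h9 hI
    simp only [run_seq_iff, run_putReal_iff]
    refine ⟨by simp, fun q hq => ?_⟩
    by_cases hqk : q = k + 1
    · subst hqk
      simp [h9, hI k hk.le, hI (k + 1) hk, Data.below_succ]
    · have : q ≤ k ↔ q ≤ k + 1 := by omega
      simpa [h9, hqk, ← this] using hI q hq
  · rintro t s' ⟨ht, hf, hI⟩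
    refine ⟨by omega, fun q hq => ?_⟩
    simpa [hq] using hI q hq

theorem run_fillSums {s : State} {H d h i j : ℕ} (hr : Ready D time c C H d s)
    (hh : s.natVar 3 = h) (hi : s.natVar 4 = i) (hj : s.natVar 5 = j) :
    Run fillSums s fun t s' => t ≤ 124 * n + 25 ∧ Filled D time h i j s' := by
  rw [fillSums]
  refine Run.seq (run_clearSums hr.n_eq).frame ?_
  rintro t₁ s₁ ⟨hf₁, ht₁, h₁⟩
  refine Run.seq (run_depositSums (hr.frame hf₁) ((hf₁.nat 3 (by decide)).trans hh)
    ((hf₁.nat 4 (by decide)).trans hi) ((hf₁.nat 5 (by decide)).trans hj) h₁).frame ?_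
  rintro t₂ s₂ ⟨hf₂, ht₂, h₂⟩
  refine (run_accumulateSums ((hr.frame hf₁).frame hf₂).n_eq h₂).frame.mono ?_
  rintro t₃ s₃ ⟨hf₃, ht₃, h₃⟩
  refine ⟨by omega, ?_, ?_, ?_, fun q hq => (h₃ q hq).1, fun q hq => (h₃ q hq).2⟩
  · rw [hf₃.nat 3 (by decide), hf₂.nat 3 (by decide), hf₁.nat 3 (by decide), hh]
  · rw [hf₃.nat 4 (by decide), hf₂.nat 4 (by decide), hf₁.nat 4 (by decide), hi]
  · rw [hf₃.nat 5 (by decide), hf₂.nat 5 (by decide), hf₁.nat 5 (by decide), hj]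

end Fill

/-! ### Preprocessing -/

/-- Replace register `r` by the minimum of its content and `e`. -/
def lowerTo (r : ℕ) (e : RealExpr) : Prog := .branch (.realLt e (.var r)) (.setReal r e) .skip

/-- Replace register `r` by the maximum of its content and `e`. -/
def raiseTo (r : ℕ) (e : RealExpr) : Prog := .branch (.realLt (.var r) e) (.setReal r e) .skip

theorem run_lowerTo {r : ℕ} {e : RealExpr} {s : State} {Q : ℕ → State → Prop}
    (h : ∀ t ≤ 2 * e.cost + 3,
      Q t { s with realVar := Function.update s.realVar r (min (e.eval s) (s.realVar r)) }) :
    Run (lowerTo r e) s Q := by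
  rw [lowerTo, run_branch_iff, run_setReal_iff, run_skip_iff]
  simp only [Test.holds, RealExpr.eval, Test.cost, RealExpr.cost]
  constructor
  · intro hlt
    have := h (e.cost + 1 + 1 + (e.cost + 1)) (by omega)
    rwa [min_eq_left hlt.le] at this
  · intro hlt
    have := h (e.cost + 1 + 1 + 1) (by have := e.cost; omega)
    rwa [min_eq_right (not_lt.1 hlt), Function.update_eq_self] at this

theorem run_raiseTo {r : ℕ} {e : RealExpr} {s : State} {Q : ℕ → State → Prop}
    (h : ∀ t ≤ 2 * e.cost + 3,
      Q t { s with realVar := Function.update s.realVar r (max (e.eval s) (s.realVar r)) }) :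
    Run (raiseTo r e) s Q := by
  rw [raiseTo, run_branch_iff, run_setReal_iff, run_skip_iff]
  simp only [Test.holds, RealExpr.eval, Test.cost, RealExpr.cost]
  constructor
  · intro hlt
    have := h (1 + e.cost + 1 + (e.cost + 1)) (by omega)
    rwa [max_eq_left hlt.le] at this
  · intro hlt
    have := h (1 + e.cost + 1 + 1) (by have := e.cost; omega)
    rwa [max_eq_right (not_lt.1 hlt), Function.update_eq_self] at this

/-- Compute `n` as a real number, the totals of both weights, and their least and greatest
value. -/
def computeTotals : Prog :=
  .seq (.setReal 6 (.lit 0)) <| .seq (.setReal 7 (.lit 0)) <| .seq (.setReal 8 (.lit 0)) <|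
  .seq (.setReal 9 (.get 2 (.lit 0))) <| .seq (.setReal 10 (.get 2 (.lit 0))) <|
  .forLt 9 0 <|
    .seq (.setReal 6 (.add (.var 6) (.lit 1))) <|
    .seq (.setReal 7 (.add (.var 7) (.get 2 (.var 9)))) <|
    .seq (.setReal 8 (.add (.var 8) (.get 3 (.var 9)))) <|
    .seq (lowerTo 9 (.get 2 (.var 9))) <| .seq (raiseTo 10 (.get 2 (.var 9))) <|
    .seq (lowerTo 9 (.get 3 (.var 9))) <| raiseTo 10 (.get 3 (.var 9))

/-- Compute the minimum support, the loss `8 c ρ ^ 5 / n` per removed point, where `ρ` is the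
ratio of the greatest and the least weight, and the largest step (at most `n`) that loses no more
than `ε`. -/
def computeStep : Prog :=
  .seq (.setReal 13 (.div (.var 2) (.var 6))) <|
  .seq (.setReal 12 (.div (.var 10) (.var 9))) <|
  .seq (.setReal 11 (.div (.mul (.mul (.lit 8) (.var 1)) (.mul (.var 12) (.mul (.var 12)
    (.mul (.var 12) (.mul (.var 12) (.var 12)))))) (.var 6))) <|
  .seq (.setReal 12 (.var 11)) <| .seq (.setNat 12 (.lit 0)) <| .seq (.setNat 2 (.lit 1)) <|
  .loop (.conj (.natLt (.var 2) (.var 0)) (.neg (.realLt (.var 0) (.var 12)))) <|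
    .seq (.setNat 2 (.add (.var 2) (.lit 1))) (.setReal 12 (.add (.var 12) (.var 11)))

/-- Compute the levels of all points by counting. -/
def computeLevels : Prog :=
  .forLt 9 0 <| .seq (.setNat 11 (.lit 0)) <|
  .seq (.forLt 10 0 (.branch (.realLt (.get 1 (.var 10)) (.get 1 (.var 9)))
    (.setNat 11 (.add (.var 11) (.lit 1))) .skip)) <|
  .putNat 0 (.var 9) (.var 11)

/-- Everything that is done before the slabs are visited. -/
def preprocess : Prog := .seq computeTotals <| .seq computeStep computeLevels

section Preprocess

variable {n : ℕ} {D : Data n} {time : Fin n → ℝ} {c C : ℝ}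

theorem run_computeTotals {s : State} {κ₁ κ₂ : ℝ} (hn : 0 < n) (hD : D.Bounded κ₁ κ₂)
    (hl : Loaded D time c C s) :
    Run computeTotals s fun t s' => t ≤ 70 * n + 20 ∧ s'.realVar 6 = n ∧
      s'.realVar 7 = ∑ p, D.m p ∧ s'.realVar 8 = ∑ p, D.b p ∧
      κ₁ ≤ s'.realVar 9 ∧ s'.realVar 10 ≤ κ₂ ∧
      D.Bounded (s'.realVar 9) (s'.realVar 10) := by
  have hm : ∀ p < n, toArray D.m p ∈ Set.Icc κ₁ κ₂ := fun p hp => by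
    simpa [toArray, hp] using (hD ⟨p, hp⟩).1
  have hb : ∀ p < n, toArray D.b p ∈ Set.Icc κ₁ κ₂ := fun p hp => by
    simpa [toArray, hp] using (hD ⟨p, hp⟩).2
  simp only [computeTotals, run_seq_iff, run_setReal_iff]
  refine (Run.forLt (N := n) (T := 60) (fun k s' => s'.realVar 6 = k ∧
    s'.realVar 7 = ∑ p ∈ Finset.range k, toArray D.m p ∧
    s'.realVar 8 = ∑ p ∈ Finset.range k, toArray D.b p ∧
    κ₁ ≤ s'.realVar 9 ∧ s'.realVar 10 ≤ κ₂ ∧ ∀ p < k,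
      (s'.realVar 9 ≤ toArray D.m p ∧ toArray D.m p ≤ s'.realVar 10) ∧
      (s'.realVar 9 ≤ toArray D.b p ∧ toArray D.b p ≤ s'.realVar 10))
    (by simpa using hl.n_eq) (by decide) (by decide) (by decide) ?_ ?_ ?_).mono ?_
  · exact fun k s a h => h
  · simpa [hl.m_eq] using hm 0 hn
  · rintro k s' hk hf h9 ⟨h6, h7, h8, hlo, hhi, hI⟩
    have e2 : s'.realArr 2 = toArray D.m := (hf.realArr 2 (by decide)).trans hl.m_eq
    have e3 : s'.realArr 3 = toArray D.b := (hf.realArr 3 (by decide)).trans hl.b_eq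
    simp only [run_seq_iff, run_setReal_iff]
    refine run_lowerTo fun t₁ ht₁ => run_raiseTo fun t₂ ht₂ => run_lowerTo fun t₃ ht₃ =>
      run_raiseTo fun t₄ ht₄ => ⟨?_, ?_, ?_, ?_, ?_, ?_, ?_⟩
    · simp only [RealExpr.cost, NatExpr.cost] at *
      omega
    · simp [h6]
    · simp [h7, Finset.sum_range_succ, e2, h9]
    · simp [h8, Finset.sum_range_succ, e3, h9]
    · simp [e2, e3, h9, hlo, (hm k hk).1, (hb k hk).1]
    · simp [e2, e3, h9, hhi, (hm k hk).2, (hb k hk).2]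
    · intro p hp
      simp only [RealExpr.eval, NatExpr.eval, Function.update_apply, Nat.reduceEqDiff, if_true,
        if_false, h9, e2, e3]
      rcases Nat.lt_succ_iff_lt_or_eq.1 hp with h | rfl
      · obtain ⟨⟨i1, i2⟩, i3, i4⟩ := hI p h
        simp [i1, i2, i3, i4]
      · simp
  · rintro t s' ⟨ht, hf, h6, h7, h8, hlo, hhi, hI⟩
    refine ⟨?_, h6, ?_, ?_, hlo, hhi, fun p => ?_⟩
    · simp
      omega
    · rw [h7, sum_range_toArray]
    · rw [h8, sum_range_toArray]
    · simpa using hI p p.2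

theorem run_computeStep {s : State} {ε ρ : ℝ} (hε : s.realVar 0 = ε) (hc : s.realVar 1 = c)
    (hC : s.realVar 2 = C) (hn : s.natVar 0 = n) (hn' : s.realVar 6 = n)
    (hρ : s.realVar 10 / s.realVar 9 = ρ) (hε0 : 0 ≤ ε) :
    Run computeStep s fun t s' => t ≤ 20 * n + 70 ∧ s'.realVar 13 = C / n ∧ s'.natVar 12 = 0 ∧
      0 < s'.natVar 2 ∧ ((s'.natVar 2 : ℝ) - 1) * (8 * c * ρ ^ 5 / n) ≤ ε ∧
      (n ≤ s'.natVar 2 ∨ ε < s'.natVar 2 * (8 * c * ρ ^ 5 / n)) := by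
  set l := 8 * c * ρ ^ 5 / n with hl
  have hl' : 8 * c * (ρ * (ρ * (ρ * (ρ * ρ)))) / n = l := by rw [hl]; ring
  simp only [computeStep, run_seq_iff, run_setReal_iff, run_setNat_iff]
  refine (Run.loop_frame (fun s' => s'.realVar 13 = C / n ∧ s'.natVar 12 = 0 ∧
    s'.realVar 11 = l ∧ s'.realVar 12 = s'.natVar 2 * l ∧
    0 < s'.natVar 2 ∧ ((s'.natVar 2 : ℝ) - 1) * l ≤ ε)
    (fun s' => 20 * (n - s'.natVar 2)) ?_ ?_).mono ?_
  · rintro s' hf ⟨h13, h12, h11, hr, h2, hI⟩ hb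
    have e0 : s'.natVar 0 = n := (hf.nat 0 (by decide)).trans (by simpa using hn)
    have e0' : s'.realVar 0 = ε := (hf.real 0 (by decide)).trans (by simpa using hε)
    simp [e0, e0', hr] at hb
    simp only [run_seq_iff, run_setReal_iff, run_setNat_iff]
    refine ⟨⟨?_, ?_, ?_, ?_, ?_, ?_⟩, ?_⟩
    · simpa using h13
    · simpa using h12
    · simpa using h11
    · simp [hr, h11]; ring
    · simp
    · simpa using hb.2
    · simp
      omega
  · simp [hC, hn', hc, hρ, hl', hε0]
  · rintro t s' ⟨hf, ⟨h13, h12, h11, hr, h2, hI⟩, hb, ht⟩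
    have e0 : s'.natVar 0 = n := (hf.nat 0 (by decide)).trans (by simpa using hn)
    have e0' : s'.realVar 0 = ε := (hf.real 0 (by decide)).trans (by simpa using hε)
    simp [e0, e0', hr] at hb
    refine ⟨?_, h13, h12, h2, hI, ?_⟩
    · simp at ht
      simp
      omega
    · by_cases h : n ≤ s'.natVar 2
      · exact .inl h
      · exact .inr (hb (by omega))

theorem run_computeLevels {s : State} (hn : s.natVar 0 = n)
    (hy : s.realArr 1 = toArray fun p => (D.pts p).2) :
    Run computeLevels s fun t s' => t ≤ n * (25 * n + 30) + 5 ∧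
      ∀ p < n, s'.natArr 0 p = D.ylevel p := by
  refine (Run.forLt (N := n) (T := 25 * n + 20) (fun k s' => ∀ p < k,
    s'.natArr 0 p = D.ylevel p) hn (by decide) (by decide) (by decide) ?_ ?_ ?_).mono ?_
  · exact fun k s a h => h
  · simp
  · intro k s' hk hf h9 hI
    have e0 : s'.natVar 0 = n := (hf.nat 0 (by decide)).trans hn
    have e1 : s'.realArr 1 = toArray fun p => (D.pts p).2 :=
      (hf.realArr 1 (by decide)).trans hy
    rw [run_seq_iff, run_setNat_iff]
    refine Run.seq (Run.forLt (N := n) (T := 15) (fun r s'' => s''.natVar 11 =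
      ((Finset.range r).filter fun p => toArray (fun p => (D.pts p).2) p <
        toArray (fun p => (D.pts p).2) k).card)
      (by simpa using e0) (by decide) (by decide) (by decide) ?_ ?_ ?_) ?_
    · exact fun k s a h => by simpa using h
    · simp
    · intro r s'' hr hf' h10 h11
      have e1' : s''.realArr 1 = toArray fun p => (D.pts p).2 :=
        (hf'.realArr 1 (by decide)).trans e1
      have e9 : s''.natVar 9 = k := (hf'.nat 9 (by decide)).trans (by simpa using h9)
      rw [run_branch_iff, Finset.range_add_one, Finset.filter_insert]
      constructor
      · intro hlt
        simp only [Test.holds, RealExpr.eval, NatExpr.eval, e1', h10, e9] at hlt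
        rw [run_setNat_iff, if_pos hlt, Finset.card_insert_of_notMem (by simp)]
        simp [h11]
      · intro hlt
        simp only [Test.holds, RealExpr.eval, NatExpr.eval, e1', h10, e9] at hlt
        rw [run_skip_iff, if_neg hlt]
        simp [h11]
    · rintro t s'' ⟨ht, hf', h11⟩
      have e9 : s''.natVar 9 = k := (hf'.nat 9 (by decide)).trans (by simpa using h9)
      have ea : s''.natArr 0 = s'.natArr 0 := hf'.natArr 0 (by decide)
      rw [run_putNat_iff]
      refine ⟨by simp; omega, fun p hp => ?_⟩
      by_cases hpk : p = k
      · subst hpk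
        simpa [e9, Data.ylevel, level] using h11
      · simpa [e9, hpk, ea] using hI p (by omega)
  · rintro t s' ⟨ht, hf, hI⟩
    have := Nat.mul_le_mul_left n (show 25 * n + 20 + 7 ≤ 25 * n + 30 by omega)
    exact ⟨by omega, hI⟩

/-- A step `d` with `(d - 1) · 8 c ρ ^ 5 / n ≤ ε` loses at most `ε`. -/
theorem Data.stepOK_of_le {l k ε : ℝ} {d : ℕ} (hn : 0 < n) (hc : 0 ≤ c) (hC : 0 < C) (hl : 0 < l)
    (hD : D.Bounded l k) (hd : ((d : ℝ) - 1) * (8 * c * (k / l) ^ 5 / n) ≤ ε) :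
    D.StepOK c C ε d := by
  intro S S' hS hsup hsup' hlt
  have hn' : (0 : ℝ) < n := by exact_mod_cast hn
  have hCn : 0 < C / n := by positivity
  have hk : 0 < k := hl.trans_le ((hD ⟨0, hn⟩).1.1.trans (hD ⟨0, hn⟩).1.2)
  refine (Data.disc_le_disc_add hc hn hl hD hS (hCn.trans_le hsup'.2.1)
    (by linarith [hsup.2.2])).trans (add_le_add le_rfl (le_trans ?_ hd))
  rw [mul_comm]
  have : ((S \ S').ncard : ℝ) + 1 ≤ d := by exact_mod_cast hlt
  gcongr
  linarith

/-- After preprocessing the number of examined cells per lower edge, `n / d + 1`, is `O(1 / ε)`: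
a further step would have lost more than `ε`, unless already `n ≤ d`. -/
theorem run_preprocess {s : State} {κ₁ κ₂ ε : ℝ} {H : ℕ} (hn : 0 < n) (hc : 0 < c) (hC : 0 < C)
    (hε : 0 < ε) (hκ : 0 < κ₁) (hD : D.Bounded κ₁ κ₂) (hl : Loaded D time c C s)
    (hεs : s.realVar 0 = ε) (hH : s.natVar 1 = H) :
    Run preprocess s fun t s' => t ≤ 250 * n ^ 2 ∧ ∃ d, 0 < d ∧ D.StepOK c C ε d ∧
      Ready D time c C H d s' ∧ s'.natVar 12 = 0 ∧
      ((n / d + 1 : ℕ) : ℝ) ≤ 2 + 8 * c * (κ₂ / κ₁) ^ 5 / ε := by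
  rw [preprocess]
  refine Run.seq (run_computeTotals hn hD hl).frame ?_
  rintro t₁ s₁ ⟨hf₁, ht₁, h6, h7, h8, h9, h10, hD'⟩
  have hl₁ := hl.frame hf₁
  refine Run.seq (run_computeStep (s := s₁) ((hf₁.real 0 (by decide)).trans hεs) hl₁.c_eq
    hl₁.C_eq hl₁.n_eq h6 rfl hε.le).frame ?_
  rintro t₂ s₂ ⟨hf₂, ht₂, h13, h12, hd, hdε, hdn⟩
  have hl₂ := hl₁.frame hf₂
  refine (run_computeLevels hl₂.n_eq hl₂.y_eq).frame.mono ?_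
  rintro t₃ s₃ ⟨hf₃, ht₃, hlev⟩
  have hl₀ : 0 < s₁.realVar 9 := hκ.trans_le h9
  have hn' : (0 : ℝ) < n := by exact_mod_cast hn
  refine ⟨?_, s₂.natVar 2, hd, Data.stepOK_of_le hn hc.le hC hl₀ hD' hdε, ⟨hl₂.frame hf₃, ?_,
    ?_, ?_, ?_, ?_, hlev⟩, ?_, ?_⟩
  · nlinarith
  · rw [hf₃.nat 1 (by decide), hf₂.nat 1 (by decide), hf₁.nat 1 (by decide), hH]
  · exact hf₃.nat 2 (by decide)
  · rw [hf₃.real 7 (by decide), hf₂.real 7 (by decide), h7]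
  · rw [hf₃.real 8 (by decide), hf₂.real 8 (by decide), h8]
  · rw [hf₃.real 13 (by decide), h13]
  · rw [hf₃.nat 12 (by decide), h12]
  · have h910 : s₁.realVar 9 ≤ s₁.realVar 10 := (hD' ⟨0, hn⟩).1.1.trans (hD' ⟨0, hn⟩).1.2
    have hκκ : κ₁ ≤ κ₂ := (hD ⟨0, hn⟩).1.1.trans (hD ⟨0, hn⟩).1.2
    have hκ₂ : 0 < κ₂ := hκ.trans_le hκκ
    have hρ : s₁.realVar 10 / s₁.realVar 9 ≤ κ₂ / κ₁ :=
      div_le_div₀ (hκ.le.trans hκκ) h10 hκ h9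
    have hρ0 : 0 ≤ s₁.realVar 10 / s₁.realVar 9 := div_nonneg (hl₀.le.trans h910) hl₀.le
    have hle : 8 * c * (s₁.realVar 10 / s₁.realVar 9) ^ 5 ≤ 8 * c * (κ₂ / κ₁) ^ 5 := by gcongr
    have hpos : 0 ≤ 8 * c * (κ₂ / κ₁) ^ 5 / ε := by positivity
    have hd' : (0 : ℝ) < s₂.natVar 2 := by exact_mod_cast hd
    push_cast
    have hdiv : ((n / s₂.natVar 2 : ℕ) : ℝ) ≤ n / s₂.natVar 2 := Nat.cast_div_le
    rcases hdn with h | h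
    · have : (n : ℝ) / s₂.natVar 2 ≤ 1 := by
        rw [div_le_one hd']
        exact_mod_cast h
      linarith
    · have : (n : ℝ) / s₂.natVar 2 ≤ 8 * c * (κ₂ / κ₁) ^ 5 / ε := by
        rw [div_le_div_iff₀ hd' hε]
        rw [mul_div_assoc', lt_div_iff₀ hn'] at h
        calc (n : ℝ) * ε = ε * n := mul_comm _ _
          _ ≤ _ := h.le
          _ ≤ s₂.natVar 2 * (8 * c * (κ₂ / κ₁) ^ 5) := by gcongr
          _ = _ := mul_comm _ _
      linarith

end Preprocess

/-! ### Searching all slabs -/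

/-- Visit all slabs; the start time ranges over the points below the bound in register `1`. -/
def search : Prog := .forLt 3 1 (.forLt 4 0 (.forLt 5 0 (.seq fillSums sweep)))

/-- Find the points through which the lower and the upper edge of the recorded region pass, and
write the region and its discrepancy to the output registers. -/
def writeOutput : Prog :=
  .seq (.setNat 18 (.var 0)) <| .seq (.setNat 19 (.lit 0)) <|
  .seq (.forLt 9 0 <| .seq
    (.branch (.conj (.neg (.natLt (.get 0 (.var 9)) (.var 16)))
        (.natLt (.get 0 (.var 9)) (.var 18)))
      (.seq (.setNat 18 (.get 0 (.var 9))) (.setNat 20 (.var 9))) .skip)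
    (.branch (.conj (.natLt (.get 0 (.var 9)) (.var 17))
        (.neg (.natLt (.get 0 (.var 9)) (.var 19))))
      (.seq (.setNat 19 (.add (.get 0 (.var 9)) (.lit 1))) (.setNat 21 (.var 9))) .skip)) <|
  .seq (.setReal 0 (.get 0 (.var 14))) <| .seq (.setReal 1 (.get 0 (.var 15))) <|
  .seq (.setReal 2 (.get 1 (.var 20))) <| .seq (.setReal 3 (.get 1 (.var 21))) <|
  .seq (.setReal 4 (.var 17)) <| .setReal 5 (.get 4 (.var 13))

/-- The scan over all regions whose start time is that of a point below the bound in
register `1`. -/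
def scan : Prog := .seq preprocess <| .seq search writeOutput

section Search

variable {n : ℕ} {D : Data n} {time : Fin n → ℝ} {c C : ℝ}

/-- Nested loops accumulate coverage: if round `k` covers the values in `V k` and keeps what was
covered before, the whole loop covers all `V k`. The counter must not be one of the registers
that hold the record. -/
theorem run_forLt_covers {i r N T : ℕ} {P : Prog} {s : State} (V : ℕ → Set ℝ)
    (hN : s.natVar r = N) (hri : r ≠ i) (hr : r ∉ P.natWrites) (hi : i ∉ P.natWrites)
    (hi12 : i < 12) (hs : Sound D time c C s)
    (step : ∀ k s', k < N → Frame (Prog.forLt i r P) s s' → s'.natVar i = k →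
      Sound D time c C s' → Run P s' fun t s'' => t ≤ T ∧ Sound D time c C s'' ∧
        (∀ z, Covers s' z → Covers s'' z) ∧ ∀ z ∈ V k, Covers s'' z) :
    Run (Prog.forLt i r P) s fun t s' => t ≤ N * (T + 7) + 5 ∧ Sound D time c C s' ∧
      (∀ z, Covers s z → Covers s' z) ∧ ∀ k < N, ∀ z ∈ V k, Covers s' z := by
  refine (Run.forLt (N := N) (T := T) (fun k s' => Sound D time c C s' ∧
    (∀ z, Covers s z → Covers s' z) ∧ ∀ k' < k, ∀ z ∈ V k', Covers s' z) hN hri hr hi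
    ?_ ?_ ?_).mono ?_
  · intro k s' a h
    have (l : ℕ) (hl : 12 ≤ l) : Function.update s'.natVar i a l = s'.natVar l :=
      Function.update_of_ne (by omega) _ _
    simpa [Sound, Covers, this] using h
  · exact ⟨hs, fun z h => h, by simp⟩
  · rintro k s' hk hf hik ⟨hS, hz, hcov⟩
    refine (step k s' hk hf hik hS).mono ?_
    rintro t s'' ⟨ht, hS', hz', hcov'⟩
    refine ⟨ht, hS', fun z h => hz' z (hz z h), fun k' hk' z h => ?_⟩
    rcases Nat.lt_succ_iff_lt_or_eq.1 hk' with h' | rfl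
    · exact hz' z (hcov k' h' z h)
    · exact hcov' z h
  · rintro t s' ⟨ht, hf, hS, hz, hcov⟩
    exact ⟨ht, hS, hz, hcov⟩

theorem run_search {s : State} {κ₁ κ₂ ε : ℝ} (hn : 0 < n) (hκ : 0 < κ₁) (hD : D.Bounded κ₁ κ₂)
    (hC : 0 < C) {H d : ℕ} (hH : 0 < H) (hd : 0 < d) (hstep : D.StepOK c C ε d)
    (hr : Ready D time c C H d s) (hs : Sound D time c C s) :
    Run search s fun t s' => t ≤ 510 * (H * n ^ 3 * (n / d + 1)) ∧ Sound D time c C s' ∧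
      ∀ h < H, ∀ i < n, ∀ j < n, ∀ u < n, ∀ v, D.Tight v →
        D.Supported C (D.cell time h i j u v) →
        Covers s' (D.disc c (D.cell time h i j u v) - ε) := by
  set J := n / d + 1 with hJ
  have hJ1 : 1 ≤ J := Nat.le_add_left _ _
  let W (h i j : ℕ) : Set ℝ := {z | ∃ u < n, ∃ v, D.Tight v ∧
    D.Supported C (D.cell time h i j u v) ∧ z = D.disc c (D.cell time h i j u v) - ε}
  have b1 : n ≤ n * J := Nat.le_mul_of_pos_right _ hJ1
  have b2 : n * J ≤ n ^ 2 * J := Nat.mul_le_mul_right _ (Nat.le_self_pow two_ne_zero n)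
  have b3 : n ^ 2 * J ≤ n ^ 3 * J :=
    Nat.mul_le_mul_right _ (Nat.pow_le_pow_right hn (by norm_num))
  have b4 : n ^ 3 * J ≤ H * (n ^ 3 * J) := Nat.le_mul_of_pos_left _ hH
  have b5 : H ≤ H * (n ^ 3 * J) := Nat.le_mul_of_pos_right _ (by positivity)
  refine (run_forLt_covers (D := D) (time := time) (c := c) (C := C)
    (T := n * (n * (470 * (n * J) + 7) + 5 + 7) + 5)
    (fun h => {z | ∃ i < n, ∃ j < n, z ∈ W h i j}) hr.H_eq (by decide) (by decide) (by decide)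
    (by decide) hs ?_).mono ?_
  · intro h s₁ hh hf₁ h3 hs₁
    have hr₁ := hr.frame hf₁
    refine (run_forLt_covers (D := D) (time := time) (c := c) (C := C)
      (T := n * (470 * (n * J) + 7) + 5)
      (fun i => {z | ∃ j < n, z ∈ W h i j}) hr₁.n_eq (by decide) (by decide) (by decide)
      (by decide) hs₁ ?_).mono ?_
    · intro i s₂ hi hf₂ h4 hs₂
      have hr₂ := hr₁.frame hf₂
      have h3₂ : s₂.natVar 3 = h := (hf₂.nat 3 (by decide)).trans h3
      refine (run_forLt_covers (D := D) (time := time) (c := c) (C := C)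
        (T := 470 * (n * J)) (W h i) hr₂.n_eq (by decide) (by decide) (by decide)
        (by decide) hs₂ ?_).mono ?_
      · intro j s₃ hj hf₃ h5 hs₃
        have hr₃ := hr₂.frame hf₃
        refine Run.seq (run_fillSums hr₃ ((hf₃.nat 3 (by decide)).trans h3₂)
          ((hf₃.nat 4 (by decide)).trans h4) h5).frame ?_
        rintro t s₄ ⟨hf₄, ht₄, hfill⟩
        refine (run_sweep hκ hD hC hd hstep (hr₃.frame hf₄) hfill (hs₃.frame hf₄)).mono ?_
        rintro t' s₅ ⟨ht₅, hs₅, hz, hcov⟩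
        refine ⟨?_, hs₅, fun z h => hz z (h.frame hf₄), ?_⟩
        · rw [← hJ, Nat.mul_add, Nat.mul_left_comm] at ht₅
          omega
        · rintro z ⟨u, hu, v, hv, hsup, rfl⟩
          exact hcov u hu v hv hsup
      · rintro t s' ⟨ht, hS, hz, hcov⟩
        exact ⟨ht, hS, hz, fun z ⟨j, hj, hzj⟩ => hcov j hj z hzj⟩
    · rintro t s' ⟨ht, hS, hz, hcov⟩
      exact ⟨ht, hS, hz, fun z ⟨i, hi, hzi⟩ => hcov i hi z hzi⟩
  · rintro t s' ⟨ht, hS, hz, hcov⟩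
    refine ⟨ht.trans ?_, hS, fun h hh i hi j hj u hu v hv hsup =>
      hcov h hh _ ⟨i, hi, j, hj, u, hu, v, hv, hsup, rfl⟩⟩
    have e : H * (n * (n * (470 * (n * J) + 7) + 5 + 7) + 5 + 7) + 5 =
      470 * (H * (n ^ 3 * J)) + 7 * (H * n ^ 2) + 12 * (H * n) + 12 * H + 5 := by ring
    have b6 : H * n ≤ H * n ^ 2 := Nat.mul_le_mul_left _ (Nat.le_self_pow two_ne_zero n)
    have b7 : H * n ^ 2 ≤ H * (n ^ 3 * J) :=
      Nat.mul_le_mul_left _ ((Nat.le_mul_of_pos_right _ hJ1).trans b3)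
    rw [e, mul_assoc H]
    omega

/-- Natural registers `20` and `21` end up with the points of least level at least `u` and of
greatest level below `q`, where `u` and `q` are recorded in registers `16` and `17`. Register `18`
holds the former level, or `n` if none was found, and register `19` the latter level plus one, or
`0` if none was found. -/
theorem run_writeOutput {s : State} {H d : ℕ} (hn : 0 < n) (hr : Ready D time c C H d s) :
    Run writeOutput s fun t s' => t ≤ 100 * n ∧ outValue s' = s.realVar 17 ∧
      ((D.cell time (s.natVar 13) (s.natVar 14) (s.natVar 15) (s.natVar 16)
          (s.natVar 17)).Nonempty →
        D.inWindow time (outRect s', outTime s') =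
          D.cell time (s.natVar 13) (s.natVar 14) (s.natVar 15) (s.natVar 16)
            (s.natVar 17)) := by
  simp only [writeOutput, run_seq_iff, run_setNat_iff]
  refine Run.mono (Run.forLt (N := n) (T := 50) (fun k s' =>
    ((∀ p < k, s.natVar 16 ≤ D.ylevel p → s'.natVar 18 ≤ D.ylevel p) ∧
      (s'.natVar 18 < n → D.ylevel (s'.natVar 20) = s'.natVar 18 ∧
        s.natVar 16 ≤ s'.natVar 18)) ∧
    (∀ p < k, D.ylevel p < s.natVar 17 → D.ylevel p < s'.natVar 19) ∧
      (0 < s'.natVar 19 → s'.natVar 21 < n ∧ s'.natVar 19 = D.ylevel (s'.natVar 21) + 1 ∧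
        D.ylevel (s'.natVar 21) < s.natVar 17))
    (by simpa using hr.n_eq) (by decide) (by decide) (by decide) ?_ ?_ ?_) ?_
  · exact fun k s a h => by simpa using h
  · simp [hr.n_eq]
  · rintro k s' hk hf h9 ⟨⟨i1, i2⟩, i3, i4⟩
    have hg : s'.natArr 0 k = D.ylevel k := by
      rw [hf.natArr 0 (by decide)]
      exact hr.level_eq k hk
    have e16 : s'.natVar 16 = s.natVar 16 := (hf.nat 16 (by decide)).trans (by simp)
    have e17 : s'.natVar 17 = s.natVar 17 := (hf.nat 17 (by decide)).trans (by simp)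
    refine Run.seq (R := fun t s'' => t ≤ 18 ∧ (∀ i, i ≠ 18 → i ≠ 20 →
      s''.natVar i = s'.natVar i) ∧ s''.natArr = s'.natArr ∧
      (∀ p < k + 1, s.natVar 16 ≤ D.ylevel p → s''.natVar 18 ≤ D.ylevel p) ∧
      (s''.natVar 18 < n → D.ylevel (s''.natVar 20) = s''.natVar 18 ∧
        s.natVar 16 ≤ s''.natVar 18)) ?_ ?_
    · rw [run_branch_iff]
      constructor
      · intro hb
        simp [h9, hg, e16] at hb
        simp only [run_seq_iff, run_setNat_iff]
        refine ⟨by simp, fun i hi hi' => by simp [hi, hi'], trivial, fun p hp hup => ?_, ?_⟩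
        · simp only [NatExpr.eval, Function.update_apply, Nat.reduceEqDiff, if_true, if_false,
            h9, hg]
          rcases Nat.lt_succ_iff_lt_or_eq.1 hp with h | rfl
          · exact hb.2.le.trans (i1 p h hup)
          · exact le_rfl
        · simp [h9, hg, hb.1]
      · intro hb
        simp [h9, hg, e16] at hb
        rw [run_skip_iff]
        refine ⟨by simp, fun i hi hi' => rfl, rfl, fun p hp hup => ?_, i2⟩
        rcases Nat.lt_succ_iff_lt_or_eq.1 hp with h | rfl
        · exact i1 p h hup
        · exact hb hup
    · rintro t s'' ⟨ht, hnat, harr, j1, j2⟩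
      have e9 : s''.natVar 9 = k := (hnat 9 (by decide) (by decide)).trans h9
      have e17' : s''.natVar 17 = s.natVar 17 := (hnat 17 (by decide) (by decide)).trans e17
      have hg' : s''.natArr 0 k = D.ylevel k := by rw [harr, hg]
      have e19 : s''.natVar 19 = s'.natVar 19 := hnat 19 (by decide) (by decide)
      have e21 : s''.natVar 21 = s'.natVar 21 := hnat 21 (by decide) (by decide)
      rw [← e19, ← e21] at i4
      simp only [← e19] at i3
      rw [run_branch_iff]
      constructor
      · intro hb
        simp [e9, hg', e17'] at hb
        simp only [run_seq_iff, run_setNat_iff]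
        refine ⟨by simp; omega, ⟨by simpa using j1, by simpa using j2⟩, fun p hp hup => ?_, ?_⟩
        · simp only [NatExpr.eval, Function.update_apply, Nat.reduceEqDiff, if_true, if_false,
            e9, hg']
          rcases Nat.lt_succ_iff_lt_or_eq.1 hp with h | rfl
          · have := i3 p h hup
            omega
          · omega
        · simp [e9, hg', hb.1, hk]
      · intro hb
        simp [e9, hg', e17'] at hb
        rw [run_skip_iff]
        refine ⟨by simp; omega, ⟨j1, j2⟩, fun p hp hup => ?_, i4⟩
        rcases Nat.lt_succ_iff_lt_or_eq.1 hp with h | rfl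
        · exact i3 p h hup
        · exact hb hup
  · rintro t s' ⟨ht, hf, ⟨i1, i2⟩, i3, i4⟩
    have e13 : s'.natVar 13 = s.natVar 13 := (hf.nat 13 (by decide)).trans (by simp)
    have e14 : s'.natVar 14 = s.natVar 14 := (hf.nat 14 (by decide)).trans (by simp)
    have e15 : s'.natVar 15 = s.natVar 15 := (hf.nat 15 (by decide)).trans (by simp)
    have er : s'.realVar 17 = s.realVar 17 := hf.real 17 (by decide)
    have ex := (hf.realArr 0 (by decide)).trans hr.x_eq
    have ey := (hf.realArr 1 (by decide)).trans hr.y_eq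
    have et := (hf.realArr 4 (by decide)).trans hr.t_eq
    simp only [run_setReal_iff]
    refine ⟨by simp; omega, by simp [outValue, er], ?_⟩
    rintro ⟨p, hp, hpu, hpq⟩
    have h18 : s'.natVar 18 < n := (i1 p p.2 hpu).trans_lt (Data.ylevel_lt p.2)
    obtain ⟨k1, k2⟩ := i2 h18
    obtain ⟨k3, k4, k5⟩ := i4 (Nat.zero_lt_of_lt (i3 p p.2 hpq))
    rw [← Data.inWindow_eq_cell (a := s'.natVar 20) (e := s'.natVar 21) k3 (k1 ▸ k2) ?_ k5 ?_]
    · simp [outRect, outTime, e13, e14, e15, ex, ey, et]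
    · exact fun p hp hup => k1.trans_le (i1 p hp hup)
    · intro p hp hup
      have := i3 p hp hup
      omega

/-- The scan answers for every region whose start time may be taken from the first `H` points. -/
theorem run_scan {s : State} {κ₁ κ₂ ε : ℝ} {H : ℕ} (hn : 0 < n) (hc : 0 < c) (hC : 0 < C)
    (hε : 0 < ε) (hκ : 0 < κ₁) (hD : D.Bounded κ₁ κ₂) (hl : Loaded D time c C s)
    (hεs : s.realVar 0 = ε) (hHs : s.natVar 1 = H) (hH : 0 < H) :
    Run scan s fun t s' =>
      (t : ℝ) ≤ 900 * (H * (n : ℝ) ^ 3 * (2 + 8 * c * (κ₂ / κ₁) ^ 5 / ε)) ∧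
      ∀ T : Rect × ℝ, (∃ h < H, ∃ i < n, ∃ j < n, ∃ u < n, ∃ v, D.Tight v ∧
          D.inWindow time T = D.cell time h i j u v) → D.Supported C (D.inWindow time T) →
        D.Supported C (D.inWindow time (outRect s', outTime s')) ∧
        outValue s' = D.disc c (D.inWindow time (outRect s', outTime s')) ∧
        D.disc c (D.inWindow time T) ≤ outValue s' + ε := by
  rw [scan]
  refine Run.seq (run_preprocess hn hc hC hε hκ hD hl hεs hHs) ?_
  rintro t₁ s₁ ⟨ht₁, d, hd, hstep, hr₁, h12, hJ⟩
  refine Run.seq (run_search hn hκ hD hC hH hd hstep hr₁ (fun h => by omega)).frame ?_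
  rintro t₂ s₂ ⟨hf₂, ht₂, hS, hcov⟩
  refine (run_writeOutput hn (hr₁.frame hf₂)).mono ?_
  rintro t₃ s₃ ⟨ht₃, hval, hwin⟩
  constructor
  · have hJ1 : 1 ≤ n / d + 1 := Nat.le_add_left _ _
    generalize n / d + 1 = J at *
    have b1 : n ≤ n ^ 3 := Nat.le_self_pow three_ne_zero n
    have b2 : n ^ 2 ≤ n ^ 3 := Nat.pow_le_pow_right hn (by norm_num)
    have b3 : n ^ 3 ≤ H * n ^ 3 := Nat.le_mul_of_pos_left _ hH
    have b4 : H * n ^ 3 ≤ H * n ^ 3 * J := Nat.le_mul_of_pos_right _ hJ1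
    have b5 : t₁ + (t₂ + t₃) ≤ 900 * (H * n ^ 3 * J) := by omega
    calc ((t₁ + (t₂ + t₃) : ℕ) : ℝ) ≤ (900 * (H * n ^ 3 * J) : ℕ) := by exact_mod_cast b5
      _ = 900 * (H * (n : ℝ) ^ 3 * (J : ℝ)) := by push_cast; ring
      _ ≤ _ := by gcongr
  · rintro T ⟨h, hh, i, hi, j, hj, u, hu, v, hv, hT⟩ hsup
    rw [hT] at hsup ⊢
    obtain ⟨hflag, hle⟩ := hcov h hh i hi j hj u hu v hv hsup
    obtain ⟨hsup', hdisc⟩ := hS hflag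
    rw [hwin (Data.Low.nonempty hC hn ⟨hsup'.1.1, hsup'.2.1⟩), hval, ← hdisc]
    exact ⟨hsup', rfl, by linarith⟩

end Search

/-! ### The two problems -/

theorem Data.supported_nonempty {n : ℕ} {D : Data n} {C : ℝ} (hC : 0 < C) (hn : 0 < n)
    {S : Set (Fin n)} (hS : D.Supported C S) : S.Nonempty :=
  Data.Low.nonempty hC hn ⟨hS.1.1, hS.2.1⟩

theorem log_three_gt_one : 1 < Real.log 3 := by
  rw [Real.lt_log_iff_exp_lt (by norm_num)]
  exact Real.exp_one_lt_three

/-- The factor `log n · log log n` is bounded below, and `ε ≤ ε₀` turns an additive constant into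
a multiple of `1 / ε`. -/
theorem le_mul_log_log {t N L ε ε₀ : ℝ} {n : ℕ} (hn : 3 ≤ n) (hN : 0 ≤ N) (hL : 0 ≤ L)
    (hε : 0 < ε) (hε₀ : ε ≤ ε₀) (ht : t ≤ N * (2 + L / ε)) :
    t ≤ (2 * ε₀ + L) / (Real.log 3 * Real.log (Real.log 3)) *
      (1 / ε * N * Real.log n * Real.log (Real.log n)) := by
  have h3 := log_three_gt_one
  have h3' : 0 < Real.log (Real.log 3) := Real.log_pos h3
  have hn3 : (3 : ℝ) ≤ n := by exact_mod_cast hn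
  have h1 : Real.log 3 ≤ Real.log n := Real.log_le_log (by norm_num) hn3
  have h2 : Real.log (Real.log 3) ≤ Real.log (Real.log n) :=
    Real.log_le_log (by linarith) h1
  have hη : 0 < Real.log 3 * Real.log (Real.log 3) := mul_pos (by linarith) h3'
  have h4 : Real.log 3 * Real.log (Real.log 3) ≤ Real.log n * Real.log (Real.log n) :=
    mul_le_mul h1 h2 h3'.le (by linarith)
  have h5 : 2 + L / ε ≤ (2 * ε₀ + L) / ε := by
    rw [add_div]
    gcongr
    rw [le_div_iff₀ hε]
    linarith
  have hε₀' : 0 < ε₀ := hε.trans_le hε₀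
  calc t ≤ N * (2 + L / ε) := ht
    _ ≤ N * ((2 * ε₀ + L) / ε) := mul_le_mul_of_nonneg_left h5 hN
    _ = N * ((2 * ε₀ + L) / ε) * 1 := (mul_one _).symm
    _ ≤ N * ((2 * ε₀ + L) / ε) * (Real.log n * Real.log (Real.log n) /
        (Real.log 3 * Real.log (Real.log 3))) := by
      refine mul_le_mul_of_nonneg_left ?_ (by positivity)
      rwa [one_le_div hη]
    _ = _ := by ring

section Problems

variable {n : ℕ} {D : Data n} {c C ε κ₁ κ₂ : ℝ}

/-- The spatial problem is the prospective problem with all timestamps zero, for which one start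
time is enough. -/
theorem run_spatial (hn : 0 < n) (hc : 0 < c) (hC : 0 < C) (hε : 0 < ε) (hκ : 0 < κ₁)
    (hD : D.Bounded κ₁ κ₂) :
    Run (.seq (.setNat 1 (.lit 1)) scan) (spatialInput D c C ε) fun t s =>
      IsAdditiveApprox (fun R : Rect => D.Supported C (D.inRect R))
        (fun R => D.disc c (D.inRect R)) ε (outRect s) (outValue s) ∧
      (t : ℝ) ≤ 1000 * (n : ℝ) ^ 3 * (2 + 8 * c * (κ₂ / κ₁) ^ 5 / ε) := by
  have hzero : toArray (fun _ : Fin n => (0 : ℝ)) = fun _ => 0 := by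
    ext; simp [toArray]
  rw [run_seq_iff, run_setNat_iff]
  refine (run_scan (D := D) (time := fun _ => 0) (H := 1) hn hc hC hε hκ hD
    ⟨rfl, rfl, rfl, rfl, rfl, rfl, rfl, hzero.symm⟩ rfl rfl one_pos).mono ?_
  rintro t s ⟨ht, hout⟩
  have hκ₂ : 0 < κ₂ := hκ.trans_le ((hD ⟨0, hn⟩).1.1.trans (hD ⟨0, hn⟩).1.2)
  have hwin : ∀ R : Rect, D.inWindow (fun _ => 0) (R, 0) = D.inRect R := fun R => by
    ext p; simp [Data.inWindow, Data.inRect]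
  have key : ∀ R : Rect, D.Supported C (D.inRect R) →
      D.Supported C (D.inRect (outRect s)) ∧ outValue s = D.disc c (D.inRect (outRect s)) ∧
        D.disc c (D.inRect R) ≤ outValue s + ε := by
    intro R hR
    rw [← hwin] at hR
    obtain ⟨h, i, j, u, v, hh, hi, hj, hu, hv, hT⟩ :=
      Data.exists_cell_eq_inWindow (R, (0 : ℝ)) (Data.supported_nonempty hC hn hR)
    have hcell : D.cell (fun _ => 0) h i j u v = D.cell (fun _ => 0) 0 i j u v := by
      simp [Data.cell, Data.InSlab, hzero]
    obtain ⟨h1, h2, h3⟩ := hout _ ⟨0, one_pos, i, hi, j, hj, u, hu, v, hv, hT.trans hcell⟩ hR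
    -- the recorded start time is not positive, since the recorded region is not empty
    have hout : D.inWindow (fun _ => 0) (outRect s, outTime s) = D.inRect (outRect s) := by
      obtain ⟨p, hp⟩ := Data.supported_nonempty hC hn h1
      ext q
      simp [Data.inWindow, Data.inRect, show outTime s ≤ 0 from hp.2]
    rw [hout] at h1 h2
    rw [hwin] at h3
    exact ⟨h1, h2, h3⟩
  refine ⟨fun ⟨R₀, hR₀⟩ => ⟨(key R₀ hR₀).1, (key R₀ hR₀).2.1, fun R hR => (key R hR).2.2⟩, ?_⟩
  have h1 : (1 : ℝ) ≤ (n : ℝ) ^ 3 := one_le_pow₀ (by exact_mod_cast hn)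
  have h2 : 0 ≤ 8 * c * (κ₂ / κ₁) ^ 5 / ε := by positivity
  simp only [NatExpr.cost]
  push_cast at ht ⊢
  nlinarith

theorem run_prospective {time : Fin n → ℝ} (hn : 0 < n) (hc : 0 < c) (hC : 0 < C) (hε : 0 < ε)
    (hκ : 0 < κ₁) (hD : D.Bounded κ₁ κ₂) :
    Run (.seq (.setNat 1 (.var 0)) scan) (prospectiveInput D time c C ε) fun t s =>
      IsAdditiveApprox (fun T : Rect × ℝ => D.Supported C (D.inWindow time T))
        (fun T => D.disc c (D.inWindow time T)) ε (outRect s, outTime s) (outValue s) ∧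
      (t : ℝ) ≤ 1000 * (n : ℝ) ^ 4 * (2 + 8 * c * (κ₂ / κ₁) ^ 5 / ε) := by
  rw [run_seq_iff, run_setNat_iff]
  refine (run_scan (D := D) (time := time) (H := n) hn hc hC hε hκ hD
    ⟨rfl, rfl, rfl, rfl, rfl, rfl, rfl, rfl⟩ rfl rfl hn).mono ?_
  rintro t s ⟨ht, hout⟩
  have hκ₂ : 0 < κ₂ := hκ.trans_le ((hD ⟨0, hn⟩).1.1.trans (hD ⟨0, hn⟩).1.2)
  have key : ∀ T : Rect × ℝ, D.Supported C (D.inWindow time T) →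
      D.Supported C (D.inWindow time (outRect s, outTime s)) ∧
        outValue s = D.disc c (D.inWindow time (outRect s, outTime s)) ∧
        D.disc c (D.inWindow time T) ≤ outValue s + ε := by
    intro T hT
    obtain ⟨h, i, j, u, v, hh, hi, hj, hu, hv, hcell⟩ :=
      Data.exists_cell_eq_inWindow T (Data.supported_nonempty hC hn hT)
    exact hout T ⟨h, hh, i, hi, j, hj, u, hu, v, hv, hcell⟩ hT
  refine ⟨fun ⟨T₀, hT₀⟩ => ⟨(key T₀ hT₀).1, (key T₀ hT₀).2.1, fun T hT => (key T hT).2.2⟩, ?_⟩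
  have h1 : (1 : ℝ) ≤ (n : ℝ) ^ 4 := one_le_pow₀ (by exact_mod_cast hn)
  have h2 : 0 ≤ 8 * c * (κ₂ / κ₁) ^ 5 / ε := by positivity
  have h3 : (n : ℝ) * (n : ℝ) ^ 3 = (n : ℝ) ^ 4 := by ring
  rw [h3] at ht
  simp only [NatExpr.cost]
  push_cast at ht ⊢
  nlinarith

/-- The constant of the time bounds: the factor `1000` collects the operation counts of the
program, `2 ε₀` and `8 c (κ₂ / κ₁) ^ 5` come from the number of candidates per lower edge, and the
denominator is the value of `log n · log log n` at `n = 3`. -/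
noncomputable def timeConstant (c κ₁ κ₂ ε₀ : ℝ) : ℝ :=
  1000 * ((2 * ε₀ + 8 * c * (κ₂ / κ₁) ^ 5) / (Real.log 3 * Real.log (Real.log 3)))

theorem timeConstant_pos {ε₀ : ℝ} (hc : 0 < c) (hκ : 0 < κ₁) (hκκ : κ₁ ≤ κ₂) (hε₀ : 0 < ε₀) :
    0 < timeConstant c κ₁ κ₂ ε₀ := by
  have h3 := log_three_gt_one
  have h3' : 0 < Real.log (Real.log 3) := Real.log_pos h3
  have hκ₂ : 0 < κ₂ := hκ.trans_le hκκ
  have h : 0 < Real.log 3 := by linarith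
  unfold timeConstant
  positivity

theorem le_timeConstant_mul {ε₀ t : ℝ} {e : ℕ} (hc : 0 < c) (hκ : 0 < κ₁) (hκκ : κ₁ ≤ κ₂)
    (hε : 0 < ε) (hε₀ : ε ≤ ε₀) (hn : 3 ≤ n)
    (ht : t ≤ 1000 * (n : ℝ) ^ e * (2 + 8 * c * (κ₂ / κ₁) ^ 5 / ε)) :
    t ≤ timeConstant c κ₁ κ₂ ε₀ *
      (1 / ε * (n : ℝ) ^ e * Real.log n * Real.log (Real.log n)) := by
  have hκ₂ : 0 < κ₂ := hκ.trans_le hκκ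
  refine (le_mul_log_log hn (by positivity) (by positivity) hε hε₀ ht).trans_eq ?_
  unfold timeConstant
  ring

end Problems

end ScanStatistic

theorem mainTheorem4 :
    (∃ P : RealRAM.Prog,
      ∀ c C κ₁ κ₂ ε₀ : ℝ, 0 < c → 0 < C → 0 < κ₁ → κ₁ ≤ κ₂ → 0 < ε₀ →
      ∃ K : ℝ, 0 < K ∧
        ∀ (n : ℕ) (D : ScanStatistic.Data n) (ε : ℝ),
          1 ≤ n → D.Bounded κ₁ κ₂ → 0 < ε → ε ≤ ε₀ →
          ∃ (t : ℕ) (s : RealRAM.State),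
            RealRAM.Exec P (ScanStatistic.spatialInput D c C ε) t s ∧
            ScanStatistic.IsAdditiveApprox
              (fun R : ScanStatistic.Rect => D.Supported C (D.inRect R))
              (fun R => D.disc c (D.inRect R)) ε
              (ScanStatistic.outRect s) (ScanStatistic.outValue s) ∧
            (3 ≤ n → (t : ℝ) ≤
              K * (1 / ε * (n : ℝ) ^ 3 * Real.log n * Real.log (Real.log n)))) ∧
    (∃ P : RealRAM.Prog,
      ∀ c C κ₁ κ₂ ε₀ : ℝ, 0 < c → 0 < C → 0 < κ₁ → κ₁ ≤ κ₂ → 0 < ε₀ →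
      ∃ K : ℝ, 0 < K ∧
        ∀ (n : ℕ) (D : ScanStatistic.Data n) (time : Fin n → ℝ) (ε : ℝ),
          1 ≤ n → D.Bounded κ₁ κ₂ → 0 < ε → ε ≤ ε₀ →
          ∃ (t : ℕ) (s : RealRAM.State),
            RealRAM.Exec P (ScanStatistic.prospectiveInput D time c C ε) t s ∧
            ScanStatistic.IsAdditiveApprox
              (fun T : ScanStatistic.Rect × ℝ => D.Supported C (D.inWindow time T))
              (fun T => D.disc c (D.inWindow time T)) ε
              (ScanStatistic.outRect s, ScanStatistic.outTime s) (ScanStatistic.outValue s) ∧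
            (3 ≤ n → (t : ℝ) ≤
              K * (1 / ε * (n : ℝ) ^ 4 * Real.log n * Real.log (Real.log n)))) := by
  refine ⟨⟨.seq (.setNat 1 (.lit 1)) ScanStatistic.scan, fun c C κ₁ κ₂ ε₀ hc hC hκ hκκ hε₀ =>
      ⟨_, ScanStatistic.timeConstant_pos hc hκ hκκ hε₀, fun n D ε hn hD hε hεε₀ => ?_⟩⟩,
    ⟨.seq (.setNat 1 (.var 0)) ScanStatistic.scan, fun c C κ₁ κ₂ ε₀ hc hC hκ hκκ hε₀ =>
      ⟨_, ScanStatistic.timeConstant_pos hc hκ hκκ hε₀, fun n D time ε hn hD hε hεε₀ => ?_⟩⟩⟩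
  · obtain ⟨t, s, he, happrox, ht⟩ :=
      ScanStatistic.run_spatial hn hc hC hε hκ hD
    exact ⟨t, s, he, happrox, fun hn3 =>
      ScanStatistic.le_timeConstant_mul hc hκ hκκ hε hεε₀ hn3 ht⟩
  · obtain ⟨t, s, he, happrox, ht⟩ :=
      ScanStatistic.run_prospective (time := time) hn hc hC hε hκ hD
    exact ⟨t, s, he, happrox, fun hn3 =>
      ScanStatistic.le_timeConstant_mul hc hκ hκκ hε hεε₀ hn3 ht⟩
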